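/- Work over $\mathbb{C}$. Let $P$ be a closed point of a scheme $X$ of finite type over $\mathbb{C}$ (for instance a variety), with local ring $\mathcal{O}_{X,P}$ and maximal ideal $\mathfrak{m}_{X,P}$. Put $\mathrm{Jac}_X := \mathrm{Fitt}^{\dim \mathcal{O}_{X,P}}(\Omega^1_{\mathcal{O}_{X,P}/\mathbb{C}})\subset\mathcal{O}_{X,P}$, let $\overline{\mathrm{Jac}_X}$ be the integral closure of this ideal, and set $$\nu_P(X):=\min\{\nu\in\mathbb{Z}_{\ge 1}\mid (\mathfrak{m}_{X,P})^{\nu-1}\subset\overline{\mathrm{Jac}_X}\}\in\mathbb{Z}_{\ge 1}\cup\{\infty\},$$ with value $\infty$ if there is no such $\nu$. Let $x_1,\dots,x_N$ be any finite system of generators of $\mathfrak{m}_{X,P}$ (for instance the coordinates, vanishing at $P$, of an embedding of the germ in $\mathbb{A}^N$). For $a\in\mathbb{C}^N$ the hyperplane section $H_a\subset X$ through $P$ is the subscheme $\sum_i a_ix_i=0$ of the germ. A general section by $c$ hyperplanes through $P$ (relative to $x_1,\dots,x_N$) is defined by $c$ such equations $\sum_i a_{ji}x_i=0$, $1\le j\le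 c$; "general" means: for all coefficients $(a_{ji})$ in some nonempty Zariski open subset of $\mathbb{C}^{c\times N}$. (1) Suppose that $P\in X$ is an isolated singularity, that is, $X\setminus\{P\}$ is smooth near $P$. Then $\nu_P(X)$ is finite and, for every finite system of generators $x_1,\dots,x_N$ of $\mathfrak{m}_{X,P}$, a general hyperplane section $H\subset X$ through $P$ satisfies $$\nu_P(H)\le\nu_P(X).$$ (2) Let $P\in V$ be a germ of a normal variety ($P$ a closed point). For integers $\delta\ge -1$ and $\nu\ge 1$, say that $P\in V$ is a singularity of type $(\delta,\nu)$ if the singular locus of the germ $V$ has dimension at most $\delta$ (it is empty if $\delta=-1$) and, for every finite system of generators of $\mathfrak{m}_{V,P}$, the section $X\subset V$ by $\delta+2$ general hyperplanes through $P$ satisfies $(\mathfrak{m}_{X,P})^{\nu-1}\subset\overline{\mathrm{Jac}_X}$. (If $\delta+2\le\dim V$, such an $X$ is a general complete intersection of codimension $\delta+2$ through $P$; otherwise it is zero-dimensional.) Then a singularity of type $(\delta,\nu)$ is also of type $(\delta',\nu')$ for all integers $\delta'\ge\delta$ and $\nu'\ge\nu$. -/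

import Mathlib

namespace SingType

open IsLocalRing

/-- The ideal of `R` generated by the minors of size `n - k` of the matrices whose rows are
relations between the `n` elements `g 0, …, g (n - 1)` of the module `M`.
For `k ≥ n` the minors have size `0`, so that the ideal is `R`. -/
def minorsIdeal {R M : Type*} [CommRing R] [AddCommGroup M] [Module R M] {n : ℕ}
    (g : Fin n → M) (k : ℕ) : Ideal R :=
  Ideal.span {d : R | ∃ (A : Matrix (Fin (n - k)) (Fin n) R) (c : Fin (n - k) → Fin n),
    (∀ i, ∑ j, A i j • g j = 0) ∧ d = (A.submatrix id c).det}

/-- The `k`-th Fitting ideal of a finitely generated module. The ideal `minorsIdeal g k` is the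
same for all finite families `g` of generators; the supremum avoids choosing one. -/
def fittingIdeal (R M : Type*) [CommRing R] [AddCommGroup M] [Module R M] (k : ℕ) : Ideal R :=
  ⨆ (n : ℕ) (g : Fin n → M) (_ : Submodule.span R (Set.range g) = ⊤), minorsIdeal g k

/-- `z` lies in the integral closure of the ideal `I`: it satisfies an equation
`z ^ n + a₁ z ^ (n - 1) + ⋯ + aₙ = 0` with `n ≥ 1` and `aᵢ ∈ I ^ i`. -/
def MemIntegralClosure {R : Type*} [CommRing R] (I : Ideal R) (z : R) : Prop :=
  ∃ n : ℕ, 1 ≤ n ∧ ∃ a : ℕ → R, (∀ i ∈ Finset.Icc 1 n, a i ∈ I ^ i) ∧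
    z ^ n + ∑ i ∈ Finset.Icc 1 n, a i * z ^ (n - i) = 0

/-- The Krull dimension as a natural number; it is used for Noetherian local rings only, whose
Krull dimension is finite. -/
noncomputable def dimNat (R : Type*) [CommRing R] : ℕ :=
  ((ringKrullDim R).unbotD 0).toNat

/-- The Jacobian ideal `Fitt^{dim R} (Ω_{R/ℂ})`. -/
noncomputable def jacobianIdeal (R : Type*) [CommRing R] [Algebra ℂ R] : Ideal R :=
  fittingIdeal R (Ω[R⁄ℂ]) (dimNat R)

/-- The power `𝔪 ^ k` of the maximal ideal of `R` is contained in the integral closure of the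
Jacobian ideal. -/
def MaxPowLeJacobian (R : Type*) [CommRing R] [IsLocalRing R] [Algebra ℂ R] (k : ℕ) : Prop :=
  ∀ z ∈ maximalIdeal R ^ k, MemIntegralClosure (jacobianIdeal R) z

/-- The invariant `ν_P(X)`, for `R` the local ring of `X` at `P`: the least integer `ν ≥ 1` such
that `𝔪 ^ (ν - 1)` is contained in the integral closure of the Jacobian ideal. Its value is `⊤`
if there is no such integer. -/
noncomputable def nu (R : Type*) [CommRing R] [IsLocalRing R] [Algebra ℂ R] : ℕ∞ :=
  ⨅ (ν : ℕ) (_ : 1 ≤ ν ∧ MaxPowLeJacobian R (ν - 1)), (ν : ℕ∞)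

/-- `R` is smooth over `ℂ` away from its closed point. The closed point may be smooth too. -/
def IsIsolatedSingularity (R : Type*) [CommRing R] [IsLocalRing R] [Algebra ℂ R] : Prop :=
  ∀ (p : Ideal R) [p.IsPrime], p ≠ maximalIdeal R → Algebra.IsSmoothAt ℂ p

/-- The singular locus of `Spec R` has dimension at most `δ`; for `δ = -1` it is empty. The
closed set of singular points is the union of the sets `Spec (R ⧸ p)`, where `p` runs over
the singular points. -/
def SingularLocusDimLE (R : Type*) [CommRing R] [Algebra ℂ R] (δ : ℤ) : Prop :=
  ∀ (p : Ideal R) [p.IsPrime], ¬ Algebra.IsSmoothAt ℂ p →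
    ∃ d : ℕ, ringKrullDim (R ⧸ p) = d ∧ (d : ℤ) ≤ δ

/-- A property holds for a general point of the affine space `σ → ℂ` (`σ` finite): it holds on a
nonempty Zariski open subset. It is enough to look at complements of hypersurfaces. -/
def ForGeneral {σ : Type*} (p : (σ → ℂ) → Prop) : Prop :=
  ∃ F : MvPolynomial σ ℂ, F ≠ 0 ∧ ∀ a : σ → ℂ, MvPolynomial.eval a F ≠ 0 → p a

/-- The ideal of `R` generated by the `c` linear forms `ℓ j = ∑ i, a (j, i) x i`. -/
def linearIdeal {R : Type*} [CommRing R] [IsLocalRing R] [Algebra ℂ R] {N : ℕ}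
    (x : Fin N → maximalIdeal R) (c : ℕ) (a : Fin c × Fin N → ℂ) : Ideal R :=
  Ideal.span (Set.range fun j : Fin c => ∑ i, a (j, i) • (x i : R))

theorem linearIdeal_ne_top {R : Type*} [CommRing R] [IsLocalRing R] [Algebra ℂ R] {N : ℕ}
    (x : Fin N → maximalIdeal R) (c : ℕ) (a : Fin c × Fin N → ℂ) : linearIdeal x c a ≠ ⊤ := by
  intro h
  have hle : linearIdeal x c a ≤ maximalIdeal R := by
    refine Ideal.span_le.2 ?_
    rintro _ ⟨j, rfl⟩
    refine Ideal.sum_mem _ fun i _ => ?_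
    rw [Algebra.smul_def]
    exact Ideal.mul_mem_left _ _ (x i).2
  exact (maximalIdeal.isMaximal R).ne_top (top_le_iff.1 (h ▸ hle))

/-- The local ring at `P` of the section of `X` by the `c` hyperplanes `ℓ j = 0` through `P`,
where `R` is the local ring of `X` at `P` and `x` are coordinates of an embedding of the germ of
`X` that vanish at `P`. -/
abbrev LinearSection {R : Type*} [CommRing R] [IsLocalRing R] [Algebra ℂ R] {N : ℕ}
    (x : Fin N → maximalIdeal R) (c : ℕ) (a : Fin c × Fin N → ℂ) : Type _ :=
  R ⧸ linearIdeal x c a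

instance {R : Type*} [CommRing R] [IsLocalRing R] [Algebra ℂ R] {N : ℕ}
    (x : Fin N → maximalIdeal R) (c : ℕ) (a : Fin c × Fin N → ℂ) :
    IsLocalRing (LinearSection x c a) :=
  haveI : Nontrivial (LinearSection x c a) :=
    Ideal.Quotient.nontrivial_iff.2 (linearIdeal_ne_top x c a)
  IsLocalRing.of_surjective' (Ideal.Quotient.mk (linearIdeal x c a)) Ideal.Quotient.mk_surjective

/-- `R`, the local ring of a normal variety `V` at `P`, is a singularity of type `(δ, ν)`, for
integers `δ ≥ -1` and `ν ≥ 1`. General complete intersections through `P` are taken in every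
embedding of the germ, that is, for all finite systems `x` of generators of the maximal ideal. -/
def IsOfType (R : Type*) [CommRing R] [IsLocalRing R] [Algebra ℂ R] (δ : ℤ) (ν : ℕ) : Prop :=
  SingularLocusDimLE R δ ∧
    ∀ (N : ℕ) (x : Fin N → maximalIdeal R), Submodule.span R (Set.range x) = ⊤ →
      ForGeneral fun a : Fin (δ + 2).toNat × Fin N → ℂ =>
        MaxPowLeJacobian (LinearSection x (δ + 2).toNat a) (ν - 1)

end SingType

/-!
Both parts rest on one fact, `forGeneral_maxPowLeJacobian_succ`: if `𝔪 ^ k` lies in the integral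
closure of the Jacobian ideal of the section by `c` general hyperplanes, it does so for the section
by `c + 1` general hyperplanes. Part (1) is the case `c = 0`, together with the finiteness of `ν`;
part (2) is an iteration of it.

The Jacobian ideal of a section of dimension `d` in coordinates `x 1, …, x N` is generated by the
minors of size `N - d` of its Jacobian matrix, whose rows are the relations between the `dx i` on
the ambient germ and the coefficient vectors of the linear forms (`jacobianIdeal_eq_rowMinors`). By
transitivity of integral dependence (`MemIntegralClosure.map_of_span`) it is enough that each minor
of the old matrix is, on the new section, integral over the minors that are bordered by the
coefficients of the new form: the dimension drops by at most one, so bordered minors have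
sufficient size. If the old minors already have size `N`, they occur in the new matrix.

For generic coefficients this is tested with the valuative criterion
(`exists_mul_pow_mem_of_valuationRing`), in valuation rings `V` centred at the generic point of the
fibre over `P`, where the residues of the coefficients are algebraically independent
(`exists_minor_dvd`). Let the minor of the old rows in the columns `d` divide all the others. By
Cramer's rule the other columns are combinations of these, with coefficients `μ` in `V`. If the
minor is no multiple of a bordered one, then, modulo the maximal ideal of `V`, the new coefficients
satisfy the same linear relations. So they are determined by `μ` and by the `k` coefficients in the
columns `d`, and the residues of `μ` and of the old coefficients have transcendence degree at least
`c N + N - k`. But these elements lie in the field `κ` generated by the ambient local ring and by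
the old coefficients, whose module of differentials is generated by the differentials of the old
coefficients and by those `dx j` for which `j` is none of the `k` columns; in characteristic zero
its transcendence degree is at most `c N + N - k`, and it exceeds that of the residues, because the
`x j` lie in the maximal ideal. If all the `x j` vanish in `V`, the bound is `c N` and the
contradiction comes from `k < N`. A generic statement specializes to general coefficients
(`exists_memIntegralClosure_borderedMinors`).

Finiteness of `ν` for an isolated singularity: at a smooth point the Jacobian ideal is not contained
in the corresponding prime (`not_jacobianIdeal_le_of_isSmoothAt`), because the module of
differentials is free there, of rank at most the dimension (`rank_le_dimNat`). The rank is the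
transcendence degree of the residue field at a minimal prime, where derivations preserve the
nilpotent elements, and Noether normalization and going down compare this degree with the
dimension.
-/


namespace SingType

open IsLocalRing

universe u

/-! ### Minors of relations and Fitting ideals -/

section Fitting

variable {R M : Type*} [CommRing R] [AddCommGroup M] [Module R M]

/-- The ideal generated by the minors of size `m` of the matrices with columns indexed by `ι`
whose rows lie in the set `S`. -/
def rowMinors {ι : Type*} (S : Set (ι → R)) (m : ℕ) : Ideal R :=
  Ideal.span {d : R | ∃ (A : Fin m → ι → R) (c : Fin m → ι),
    (∀ i, A i ∈ S) ∧ d = (Matrix.of fun i j => A i (c j)).det}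

/-- The module of relations between the elements of a finite family. -/
def relations {ι : Type*} [Fintype ι] (g : ι → M) : Submodule R (ι → R) :=
  LinearMap.ker (Fintype.linearCombination R g)

theorem mem_relations {ι : Type*} [Fintype ι] {g : ι → M} {v : ι → R} :
    v ∈ relations (R := R) g ↔ ∑ i, v i • g i = 0 := by
  simp [relations, Fintype.linearCombination_apply]

theorem minorsIdeal_eq_rowMinors {n : ℕ} (g : Fin n → M) (k : ℕ) :
    minorsIdeal (R := R) g k = rowMinors (relations (R := R) g : Set (Fin n → R)) (n - k) := by
  simp only [minorsIdeal, rowMinors, SetLike.mem_coe, mem_relations]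
  rfl

theorem rowMinors_mono {ι : Type*} {S S' : Set (ι → R)} (h : S ⊆ S') (m : ℕ) :
    rowMinors S m ≤ rowMinors S' m := by
  refine Ideal.span_mono ?_
  rintro _ ⟨A, c, hA, rfl⟩
  exact ⟨A, c, fun i => h (hA i), rfl⟩

theorem det_mem_rowMinors {ι n : Type*} [Fintype n] [DecidableEq n] {S : Set (ι → R)} {m : ℕ}
    (hm : Fintype.card n = m) (A : n → ι → R) (hA : ∀ i, A i ∈ S) (c : n → ι) :
    (Matrix.of fun i j => A i (c j)).det ∈ rowMinors S m := by
  let e : Fin m ≃ n := (Fintype.equivFinOfCardEq hm).symm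
  refine Ideal.subset_span ⟨A ∘ e, c ∘ e, fun i => hA (e i), ?_⟩
  rw [← Matrix.det_submatrix_equiv_self e]
  rfl

theorem rowMinors_zero {ι : Type*} (S : Set (ι → R)) : rowMinors S 0 = ⊤ := by
  rw [Ideal.eq_top_iff_one]
  have := det_mem_rowMinors (S := S) (n := Fin 0) (m := 0) rfl (fun i => i.elim0)
    (fun i => i.elim0) (fun i => i.elim0)
  simpa using this

theorem rowMinors_succ_le {ι : Type*} (S : Set (ι → R)) (m : ℕ) :
    rowMinors S (m + 1) ≤ rowMinors S m := by
  refine Ideal.span_le.2 ?_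
  rintro _ ⟨A, c, hA, rfl⟩
  rw [Matrix.det_succ_row_zero]
  refine Ideal.sum_mem _ fun j _ => Ideal.mul_mem_left _ _ ?_
  exact det_mem_rowMinors (Fintype.card_fin m) (fun i => A i.succ) (fun i => hA _)
    (fun i => c (j.succAbove i))

theorem rowMinors_antitone {ι : Type*} (S : Set (ι → R)) : Antitone (rowMinors S) :=
  antitone_nat_of_succ_le (rowMinors_succ_le S)

/-- A multilinear map that sends families in `S` into a submodule does the same for families in the
span of `S`. -/
theorem multilinearMap_mem_of_mem_span {n N : Type*} [Finite n] [AddCommGroup N] [Module R N]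
    (f : MultilinearMap R (fun _ : n => M) N) (J : Submodule R N) (S : Set M)
    (h : ∀ v : n → M, (∀ i, v i ∈ S) → f v ∈ J) (v : n → M)
    (hv : ∀ i, v i ∈ Submodule.span R S) : f v ∈ J := by
  classical
  cases nonempty_fintype n
  suffices H : ∀ (s : Finset n) (v : n → M), (∀ i ∈ s, v i ∈ Submodule.span R S) →
      (∀ i ∉ s, v i ∈ S) → f v ∈ J from
    H Finset.univ v (fun i _ => hv i) (fun i hi => absurd (Finset.mem_univ i) hi)
  intro s
  induction s using Finset.induction_on with
  | empty => exact fun v _ hv => h v fun i => hv i (Finset.notMem_empty i)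
  | insert i s hi ih =>
    intro v hv hv'
    suffices H : ∀ x ∈ Submodule.span R S, f (Function.update v i x) ∈ J by
      simpa using H (v i) (hv i (Finset.mem_insert_self i s))
    intro x hx
    induction hx using Submodule.span_induction with
    | mem x hx =>
      refine ih _ (fun j hj => ?_) (fun j hj => ?_)
      · rw [Function.update_of_ne (ne_of_mem_of_not_mem hj hi)]
        exact hv j (Finset.mem_insert_of_mem hj)
      · by_cases e : j = i
        · subst e; simpa using hx
        · rw [Function.update_of_ne e]
          exact hv' j (by simp [e, hj])
    | zero => rw [f.map_update_zero]; exact J.zero_mem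
    | add x y _ _ hx hy => rw [f.map_update_add]; exact J.add_mem hx hy
    | smul r x _ hx => rw [f.map_update_smul]; exact J.smul_mem r hx

/-- By multilinearity of the determinant in the rows, rows from a generating set suffice. -/
theorem rowMinors_span {ι : Type*} (S : Set (ι → R)) (m : ℕ) :
    rowMinors (Submodule.span R S : Set (ι → R)) m = rowMinors S m := by
  refine le_antisymm (Ideal.span_le.2 ?_) (rowMinors_mono Submodule.subset_span m)
  rintro _ ⟨A, c, hA, rfl⟩
  have := multilinearMap_mem_of_mem_span
    ((Matrix.detRowAlternating (R := R) (n := Fin m)).toMultilinearMap.compLinearMap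
      fun _ => LinearMap.funLeft R R c) (rowMinors S m) S
    (fun v hv => det_mem_rowMinors (Fintype.card_fin m) v hv c) A hA
  exact this

theorem rowMinors_relations_comp_equiv {ι ι' : Type*} [Fintype ι] [Fintype ι'] (e : ι ≃ ι')
    (g : ι' → M) (m : ℕ) :
    rowMinors (relations (R := R) (g ∘ e) : Set (ι → R)) m =
      rowMinors (relations (R := R) g : Set (ι' → R)) m := by
  refine le_antisymm ?_ ?_
  · refine Ideal.span_le.2 ?_
    rintro _ ⟨A, c, hA, rfl⟩
    have := det_mem_rowMinors (S := (relations (R := R) g : Set (ι' → R))) (Fintype.card_fin m)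
      (fun i j => A i (e.symm j)) (fun i => ?_) (e ∘ c)
    · simpa using this
    · have h := mem_relations.1 (hA i)
      refine mem_relations.2 ?_
      rw [← h, ← e.sum_comp]
      simp
  · refine Ideal.span_le.2 ?_
    rintro _ ⟨A, c, hA, rfl⟩
    have := det_mem_rowMinors (S := (relations (R := R) (g ∘ e) : Set (ι → R)))
      (Fintype.card_fin m) (fun i j => A i (e j)) (fun i => ?_) (e.symm ∘ c)
    · simpa using this
    · have h := mem_relations.1 (hA i)
      refine mem_relations.2 ?_
      rw [← h, ← e.sum_comp]
      rfl

/-- If one more element `h` of the span is added to the generators, minors one size larger give the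
same ideal. This inclusion borders a matrix by the relation that expresses `h`. -/
theorem rowMinors_relations_le_option {ι : Type*} [Fintype ι] (g : ι → M) (h : M)
    (hh : h ∈ Submodule.span R (Set.range g)) (m : ℕ) :
    rowMinors (relations (R := R) g : Set (ι → R)) m ≤
      rowMinors (relations (R := R) (fun o : Option ι => o.elim h g) : Set (Option ι → R))
        (m + 1) := by
  obtain ⟨r, hr⟩ := (Submodule.mem_span_range_iff_exists_fun R).1 hh
  refine Ideal.span_le.2 ?_
  rintro _ ⟨A, c, hA, rfl⟩
  have := det_mem_rowMinors
    (S := (relations (R := R) (fun o : Option ι => o.elim h g) : Set (Option ι → R)))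
    (n := Fin m ⊕ Unit) (m := m + 1) (by simp)
    (Sum.elim (fun i o => o.elim 0 (A i)) (fun _ o => o.elim 1 (fun j => - r j)))
    (fun i => ?_) (Sum.elim (fun j => some (c j)) (fun _ => none))
  · have e : (Matrix.of fun (i j : Fin m ⊕ Unit) =>
        (Sum.elim (fun i (o : Option ι) => o.elim 0 (A i))
          (fun _ o => o.elim 1 (fun j => - r j)) i : Option ι → R)
          (Sum.elim (fun j => some (c j)) (fun _ : Unit => none) j : Option ι)) =
        Matrix.fromBlocks (Matrix.of fun i j => A i (c j)) 0
          (Matrix.of fun _ j => - r (c j)) 1 := by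
      ext (i | i) (j | j) <;> simp
    rw [e, Matrix.det_fromBlocks_zero₁₂, Matrix.det_one, mul_one] at this
    exact this
  · rcases i with i | i
    · simpa [mem_relations] using mem_relations.1 (hA i)
    · simp [mem_relations, hr]

/-- The inclusion opposite to `rowMinors_relations_le_option`: up to multiples of the relation that
expresses `h`, each relation is free of `h`. -/
theorem rowMinors_relations_option_le {ι : Type*} [Fintype ι] (g : ι → M) (h : M)
    (hh : h ∈ Submodule.span R (Set.range g)) (m : ℕ) :
    rowMinors (relations (R := R) (fun o : Option ι => o.elim h g) : Set (Option ι → R))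
        (m + 1) ≤ rowMinors (relations (R := R) g : Set (ι → R)) m := by
  obtain ⟨r, hr⟩ := (Submodule.mem_span_range_iff_exists_fun R).1 hh
  let S : Set (Option ι → R) := {v | v none = 0 ∧ (fun i => v (some i)) ∈ relations (R := R) g}
  let e : Option ι → R := fun o => o.elim 1 (fun j => - r j)
  have hspan : (relations (R := R) (fun o : Option ι => o.elim h g) : Set (Option ι → R)) ⊆
      Submodule.span R (insert e S) := by
    intro v hv
    have hv := mem_relations.1 hv
    have : v = (v - v none • e) + v none • e := by simp
    rw [this]
    refine add_mem (Submodule.subset_span (Set.mem_insert_of_mem _ ⟨by simp [e], ?_⟩))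
      (Submodule.smul_mem _ _ (Submodule.subset_span (Set.mem_insert _ _)))
    rw [mem_relations]
    rw [Fintype.sum_option] at hv
    simp only [Option.elim_none, Option.elim_some] at hv
    simp only [Pi.sub_apply, Pi.smul_apply, e, Option.elim_some, smul_eq_mul, mul_neg,
      sub_neg_eq_add, add_smul, Finset.sum_add_distrib, mul_smul, ← Finset.smul_sum, hr]
    rw [add_comm]
    exact hv
  have hS : ∀ (m : ℕ) (A : Fin m → Option ι → R) (c : Fin m → Option ι), (∀ i, A i ∈ S) →
      (Matrix.of fun i j => A i (c j)).det ∈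
        rowMinors (relations (R := R) g : Set (ι → R)) m := by
    intro m A c hA
    by_cases hc : ∃ j, c j = none
    · obtain ⟨j, hj⟩ := hc
      rw [Matrix.det_eq_zero_of_column_eq_zero j fun i => by simp [hj, (hA i).1]]
      exact Ideal.zero_mem _
    · push Not at hc
      choose c' hc' using fun j => Option.ne_none_iff_exists'.1 (hc j)
      simp only [hc']
      exact det_mem_rowMinors (Fintype.card_fin m) (fun i j => A i (some j))
        (fun i => (hA i).2) c'
  refine (rowMinors_mono hspan _).trans ?_
  rw [rowMinors_span]
  refine Ideal.span_le.2 ?_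
  rintro _ ⟨A, c, hA, rfl⟩
  by_cases hA' : ∀ i, A i ∈ S
  · exact rowMinors_succ_le _ _ (hS _ A c hA')
  -- a row equal to `e` occurs once, and the determinant is expanded along it
  push Not at hA'
  obtain ⟨i₀, hi₀⟩ := hA'
  have hi₀ : A i₀ = e := (hA i₀).resolve_right hi₀
  by_cases h2 : ∃ i₁, i₁ ≠ i₀ ∧ A i₁ = e
  · obtain ⟨i₁, hne, hi₁⟩ := h2
    rw [Matrix.det_zero_of_row_eq hne]
    · exact Ideal.zero_mem _
    · ext j; simp [hi₁, hi₀]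
  · push Not at h2
    rw [Matrix.det_succ_row _ i₀]
    refine Ideal.sum_mem _ fun j _ => Ideal.mul_mem_left _ _ ?_
    exact hS m (fun i => A (i₀.succAbove i)) (fun i => c (j.succAbove i))
      (fun i => (hA _).resolve_left (h2 _ (Fin.succAbove_ne i₀ i)))

theorem rowMinors_relations_sum {ι : Type*} [Fintype ι] (g : ι → M) (m n : ℕ) (g' : Fin n → M)
    (hg' : ∀ i, g' i ∈ Submodule.span R (Set.range g)) :
    rowMinors (relations (R := R) (Sum.elim g g') : Set (ι ⊕ Fin n → R)) (m + n) =
      rowMinors (relations (R := R) g : Set (ι → R)) m := by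
  induction n with
  | zero =>
    rw [← rowMinors_relations_comp_equiv (Equiv.sumEmpty ι (Fin 0)).symm]
    rfl
  | succ n ih =>
    rw [← ih (fun i => g' i.castSucc) (fun i => hg' _)]
    let e : Option (ι ⊕ Fin n) ≃ ι ⊕ Fin (n + 1) :=
      (Equiv.optionEquivSumPUnit.{0} _).trans ((Equiv.sumAssoc _ _ _).trans
        (Equiv.sumCongr (Equiv.refl _) ((Equiv.optionEquivSumPUnit.{0} _).symm.trans
          finSuccEquivLast.symm)))
    have he : Sum.elim g g' ∘ e = fun o => o.elim (g' (Fin.last n))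
        (Sum.elim g fun i => g' i.castSucc) := by
      funext o
      rcases o with _ | (i | i) <;> simp [e]
    rw [← rowMinors_relations_comp_equiv e, he]
    have hh : g' (Fin.last n) ∈
        Submodule.span R (Set.range (Sum.elim g fun i : Fin n => g' i.castSucc)) := by
      rw [Set.Sum.elim_range]
      exact Submodule.span_mono Set.subset_union_left (hg' _)
    exact le_antisymm (rowMinors_relations_option_le _ _ hh _)
      (rowMinors_relations_le_option _ _ hh _)

/-- Two families of generators are compared through their union. -/
theorem minorsIdeal_le_minorsIdeal {n n' : ℕ} (g : Fin n → M) (g' : Fin n' → M)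
    (hg : Submodule.span R (Set.range g) = ⊤) (hg' : Submodule.span R (Set.range g') = ⊤)
    (k : ℕ) : minorsIdeal (R := R) g k ≤ minorsIdeal (R := R) g' k := by
  rw [minorsIdeal_eq_rowMinors, minorsIdeal_eq_rowMinors]
  rcases le_or_gt n' k with hk | hk
  · rw [Nat.sub_eq_zero_of_le hk, rowMinors_zero]
    exact le_top
  rw [← rowMinors_relations_sum g _ n' g' (by simp [hg]),
    ← rowMinors_relations_sum g' _ n g (by simp [hg']),
    ← rowMinors_relations_comp_equiv (Equiv.sumComm (Fin n) (Fin n')) (Sum.elim g' g)]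
  have : Sum.elim g' g ∘ Equiv.sumComm (Fin n) (Fin n') = Sum.elim g g' := by
    funext i; rcases i with i | i <;> rfl
  rw [this]
  exact rowMinors_antitone _ (by omega)

/-- Fitting's lemma: any finite family of generators computes the Fitting ideals. -/
theorem fittingIdeal_eq {n : ℕ} (g : Fin n → M) (hg : Submodule.span R (Set.range g) = ⊤)
    (k : ℕ) : fittingIdeal R M k = rowMinors (relations (R := R) g : Set (Fin n → R)) (n - k) := by
  rw [← minorsIdeal_eq_rowMinors]
  refine le_antisymm ?_ ?_
  · exact iSup_le fun n' => iSup_le fun g' => iSup_le fun hg' =>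
      minorsIdeal_le_minorsIdeal g' g hg' hg k
  · exact le_iSup_of_le n (le_iSup_of_le g (le_iSup_of_le hg le_rfl))

end Fitting

/-! ### Integral closure of ideals and valuation rings -/

section IntegralClosure

/-- A pair of primes `q ≤ Q` of a ring is realized by a valuation ring centred at `Q` whose
generic point lies over `q`. -/
theorem exists_valuationRing_of_le {B : Type u} [CommRing B] (q Q : Ideal B) [q.IsPrime]
    [Q.IsPrime] (h : q ≤ Q) :
    ∃ (K : Type u) (_ : Field K) (V : ValuationSubring K) (ψ : B →+* V),
      (maximalIdeal V).comap ψ = Q ∧ RingHom.ker ψ = q := by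
  let f : Localization.AtPrime Q →+* q.ResidueField :=
    IsLocalization.lift (M := Q.primeCompl) (g := algebraMap B q.ResidueField) fun y => by
      rw [isUnit_iff_ne_zero, Ne, Ideal.algebraMap_residueField_eq_zero]
      exact fun hy => y.2 (h hy)
  obtain ⟨V, hV, hloc⟩ := IsLocalRing.exists_factor_valuationRing f
  refine ⟨q.ResidueField, inferInstance, V,
    (f.codRestrict V.toSubring hV).comp (algebraMap B (Localization.AtPrime Q)), ?_, ?_⟩
  · rw [← Ideal.comap_comap]
    have : (maximalIdeal V).comap (f.codRestrict V.toSubring hV) =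
        maximalIdeal (Localization.AtPrime Q) := by
      ext x
      rw [Ideal.mem_comap, mem_maximalIdeal, mem_maximalIdeal, mem_nonunits_iff, mem_nonunits_iff]
      exact not_congr (isUnit_map_iff (f.codRestrict V.toSubring hV) x)
    rw [this]
    exact IsLocalization.AtPrime.under_maximalIdeal (Localization.AtPrime Q) Q
  · ext x
    rw [RingHom.mem_ker, ← Ideal.algebraMap_residueField_eq_zero (I := q), ← Subtype.coe_inj]
    have : (((f.codRestrict V.toSubring hV).comp (algebraMap B (Localization.AtPrime Q)) x : V) :
        q.ResidueField) = f (algebraMap B (Localization.AtPrime Q) x) := rfl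
    rw [this, IsLocalization.lift_eq]
    rfl

variable {T : Type u} [CommRing T]

theorem sup_span_pow_succ_le (I : Ideal T) (z : T) (n : ℕ) :
    (I ⊔ Ideal.span {z}) ^ (n + 1) ≤
      I * (I ⊔ Ideal.span {z}) ^ n ⊔ Ideal.span {z ^ (n + 1)} := by
  induction n with
  | zero => simp
  | succ n ih =>
    rw [pow_succ (n := n + 1), pow_succ (n := n)]
    calc _ ≤ (I * (I ⊔ Ideal.span {z}) ^ n ⊔ Ideal.span {z ^ (n + 1)}) *
          (I ⊔ Ideal.span {z}) := Ideal.mul_mono_left (by rwa [← pow_succ])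
      _ ≤ _ := ?_
    rw [Ideal.sup_mul, mul_assoc]
    refine sup_le le_sup_left ?_
    rw [Ideal.mul_sup, Ideal.span_singleton_mul_span_singleton, ← pow_succ z]
    refine sup_le (le_sup_of_le_left ?_) le_sup_right
    rw [mul_comm]
    refine Ideal.mul_mono_right ?_
    rw [← pow_succ, ← Ideal.span_singleton_pow]
    exact Ideal.pow_right_mono le_sup_right _

/-- The blowup algebra `T[I / z]`, as a subalgebra of the localization `T[1 / z]`. -/
def blowupAlgebra (I : Ideal T) (z : T) : Subalgebra T (Localization.Away z) where
  carrier := {y | ∃ n, ∃ b ∈ (I ⊔ Ideal.span {z}) ^ n,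
    y * algebraMap T _ (z ^ n) = algebraMap T _ b}
  mul_mem' := by
    rintro y y' ⟨n, b, hb, h⟩ ⟨n', b', hb', h'⟩
    refine ⟨n + n', b * b', pow_add (I ⊔ Ideal.span {z}) n n' ▸ Ideal.mul_mem_mul hb hb', ?_⟩
    rw [map_mul, ← h, ← h', pow_add, map_mul]
    ring
  add_mem' := by
    rintro y y' ⟨n, b, hb, h⟩ ⟨n', b', hb', h'⟩
    have hz (k : ℕ) : z ^ k ∈ (I ⊔ Ideal.span {z}) ^ k :=
      Ideal.pow_mem_pow (Ideal.mem_sup_right (Ideal.mem_span_singleton_self z)) k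
    refine ⟨n + n', b * z ^ n' + z ^ n * b', pow_add (I ⊔ Ideal.span {z}) n n' ▸
      add_mem (Ideal.mul_mem_mul hb (hz _)) (Ideal.mul_mem_mul (hz _) hb'), ?_⟩
    rw [map_add, map_mul, map_mul, ← h, ← h', pow_add, map_mul]
    ring
  algebraMap_mem' r := ⟨0, r, by simp, by simp⟩

/-- The ideal of the fractions `b / z ^ (n + 1)` of the blowup algebra `T[I / z]` whose numerators
lie in `P (I + (z)) ^ n`. -/
def blowupIdeal (I P : Ideal T) (z : T) : Ideal (blowupAlgebra I z) where
  carrier := {y | ∃ n, ∃ b ∈ P * (I ⊔ Ideal.span {z}) ^ n,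
    (y : Localization.Away z) * algebraMap T _ (z ^ (n + 1)) = algebraMap T _ b}
  zero_mem' := ⟨0, 0, by simp, by simp⟩
  add_mem' := by
    rintro y y' ⟨n, b, hb, h⟩ ⟨n', b', hb', h'⟩
    have hz (k : ℕ) : z ^ k ∈ (I ⊔ Ideal.span {z}) ^ k :=
      Ideal.pow_mem_pow (Ideal.mem_sup_right (Ideal.mem_span_singleton_self z)) k
    refine ⟨n + n' + 1, b * z ^ (n' + 1) + b' * z ^ (n + 1), add_mem ?_ ?_, ?_⟩
    · rw [add_assoc, pow_add, ← mul_assoc]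
      exact Ideal.mul_mem_mul hb (hz _)
    · rw [show n + n' + 1 = n' + (n + 1) by ring, pow_add, ← mul_assoc]
      exact Ideal.mul_mem_mul hb' (hz _)
    · rw [map_add, map_mul, map_mul, ← h, ← h',
        show n + n' + 1 + 1 = (n + 1) + (n' + 1) by ring, pow_add, map_mul]
      push_cast
      ring
  smul_mem' := by
    rintro y y' ⟨n', b', hb', h'⟩
    obtain ⟨n, b, hb, h⟩ := y.2
    refine ⟨n + n', b * b', ?_, ?_⟩
    · rw [pow_add, mul_left_comm]
      exact Ideal.mul_mem_mul hb hb'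
    · rw [map_mul, ← h, ← h', add_assoc, pow_add, map_mul, smul_eq_mul]
      push_cast
      ring

/-- The valuative criterion for integral dependence on an ideal, locally at a prime. If integral
dependence fails at `𝔮`, then the ideal generated by `I / z` and `𝔮` in the blowup algebra is
proper at `𝔮`, and a valuation ring that dominates a prime containing it contradicts `H`. -/
theorem exists_mul_pow_mem_of_valuationRing (I : Ideal T) (z : T) (𝔮 : Ideal T) [𝔮.IsPrime]
    (H : ∀ (K : Type u) [Field K] (V : ValuationSubring K) (φ : T →+* V),
      (maximalIdeal V).comap φ = 𝔮 → φ z ≠ 0 → ∃ b ∈ I, φ b ∣ φ z) :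
    ∃ g ∉ 𝔮, ∃ n : ℕ, g * z ^ (n + 1) ∈ I * (I ⊔ Ideal.span {z}) ^ n := by
  by_contra! hcon
  set N := I ⊔ Ideal.span {z} with hN
  have hzN : z ∈ N := Ideal.mem_sup_right (Ideal.mem_span_singleton_self z)
  let B := blowupAlgebra I z
  let J : Ideal B := blowupIdeal I (I ⊔ 𝔮 * N) z
  have hdisj : Disjoint (J : Set B) (𝔮.primeCompl.map (algebraMap T B) : Submonoid B) := by
    rw [Set.disjoint_left]
    rintro _ ⟨n, b, hb, h⟩ ⟨g, hg, rfl⟩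
    have h : algebraMap T (Localization.Away z) (g * z ^ (n + 1)) = algebraMap T _ b := by
      rw [map_mul]; exact h
    obtain ⟨⟨_, k, rfl⟩, hk⟩ := (IsLocalization.eq_iff_exists (Submonoid.powers z) _).1 h
    have hmem : g * z ^ (n + k + 1) ∈ I * N ^ (n + k) ⊔ 𝔮 * Ideal.span {z ^ (n + k + 1)} := by
      have h1 : g * z ^ (n + k + 1) = b * z ^ k := by
        simp only at hk
        rw [mul_comm b, ← hk]; ring
      have h2 : b * z ^ k ∈ (I ⊔ 𝔮 * N) * N ^ (n + k) := by
        rw [pow_add, ← mul_assoc]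
        exact Ideal.mul_mem_mul hb (Ideal.pow_mem_pow hzN k)
      rw [h1]
      refine (?_ : (I ⊔ 𝔮 * N) * N ^ (n + k) ≤ _) h2
      rw [Ideal.sup_mul, mul_assoc, ← pow_succ']
      refine sup_le le_sup_left ?_
      refine (Ideal.mul_mono_right (sup_span_pow_succ_le I z (n + k))).trans ?_
      rw [Ideal.mul_sup]
      exact sup_le_sup Ideal.mul_le_right le_rfl
    obtain ⟨u, hu, v, hv, huv⟩ := Submodule.mem_sup.1 hmem
    obtain ⟨q, hq, rfl⟩ := Ideal.mem_mul_span_singleton.1 hv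
    refine hcon (g - q) (fun hgq => hg ?_) (n + k) ?_
    · simpa using add_mem hgq hq
    · rw [sub_mul, ← huv]
      simpa using hu
  -- a minimal prime `q` below `Q` does not contain the nonzerodivisor `z`
  obtain ⟨Q, hQ, hJQ, hQd⟩ := Ideal.exists_le_prime_disjoint J _ hdisj
  obtain ⟨q, hq, hqQ⟩ := Ideal.exists_minimalPrimes_le (I := (⊥ : Ideal B)) (J := Q) bot_le
  have : q.IsPrime := hq.1.1
  obtain ⟨K, _, V, ψ, hψQ, hψq⟩ := exists_valuationRing_of_le q Q hqQ
  have hcomap : Q.comap (algebraMap T B) = 𝔮 := by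
    ext t
    rw [Ideal.mem_comap]
    constructor
    · intro ht
      by_contra ht'
      exact Set.disjoint_left.1 hQd ht ⟨t, ht', rfl⟩
    · intro ht
      refine hJQ ⟨0, t * z, ?_, by simp⟩
      rw [pow_zero, Ideal.one_eq_top, Ideal.mul_top]
      exact Ideal.mem_sup_right (Ideal.mul_mem_mul ht hzN)
  have hzu : IsUnit (algebraMap T (Localization.Away z) z) :=
    IsLocalization.Away.algebraMap_isUnit z
  have hz0 : ψ (algebraMap T B z) ≠ 0 := by
    intro h0
    have h0 : algebraMap T B z ∈ q := by rw [← hψq]; exact h0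
    refine Set.disjoint_left.1 (Ideal.disjoint_nonZeroDivisors_of_mem_minimalPrimes hq) h0 ?_
    refine mem_nonZeroDivisors_iff_right.2 fun y hy => ?_
    have hy : (y : Localization.Away z) * algebraMap T _ z = 0 := congrArg Subtype.val hy
    exact Subtype.ext (hzu.mul_left_eq_zero.1 hy)
  obtain ⟨b, hb, hdvd⟩ := H K V (ψ.comp (algebraMap T B))
    (by rw [← Ideal.comap_comap, hψQ, hcomap]) hz0
  have hyB : ∃ y ∈ J, y * algebraMap T B z = algebraMap T B b := by
    have e : algebraMap T (Localization.Away z) b * ↑(hzu.unit⁻¹) * algebraMap T _ z =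
        algebraMap T _ b := by
      rw [mul_assoc]; simp
    have hB : algebraMap T (Localization.Away z) b * ↑(hzu.unit⁻¹) ∈ B :=
      ⟨1, b, by rw [pow_one]; exact Ideal.mem_sup_left hb, by rw [pow_one, e]⟩
    refine ⟨⟨_, hB⟩, ⟨0, b, ?_, ?_⟩, Subtype.ext e⟩
    · rw [pow_zero, mul_one]; exact Ideal.mem_sup_left hb
    · rw [zero_add, pow_one]; exact e
  obtain ⟨y, hyJ, hy⟩ := hyB
  have hyV : ψ y ∈ maximalIdeal V := by
    have : y ∈ (maximalIdeal V).comap ψ := by rw [hψQ]; exact hJQ hyJ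
    exact this
  obtain ⟨d, hd⟩ := hdvd
  have hunit : ψ y * d = 1 := by
    refine mul_right_cancel₀ hz0 ?_
    rw [one_mul]
    calc ψ y * d * ψ (algebraMap T B z) = ψ (y * algebraMap T B z) * d := by rw [map_mul]; ring
      _ = _ := by rw [hy]; exact hd.symm
  exact (mem_maximalIdeal _).1 hyV (IsUnit.of_mul_eq_one _ hunit)

/-- Integral dependence on `I`, with the equation replaced by membership in an ideal. -/
theorem memIntegralClosure_iff {I : Ideal T} {z : T} :
    MemIntegralClosure I z ↔ ∃ n : ℕ, z ^ (n + 1) ∈ I * (I ⊔ Ideal.span {z}) ^ n := by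
  constructor
  · rintro ⟨n, hn, a, ha, h⟩
    obtain ⟨n, rfl⟩ := Nat.exists_eq_add_of_le' hn
    refine ⟨n, ?_⟩
    rw [eq_neg_of_add_eq_zero_left h]
    refine neg_mem (sum_mem fun i hi => ?_)
    have hi' := Finset.mem_Icc.1 hi
    obtain ⟨i, rfl⟩ := Nat.exists_eq_add_of_le' hi'.1
    rw [show n + 1 - (i + 1) = n - i by omega]
    have e : I * (I ⊔ Ideal.span {z}) ^ n =
        I * (I ⊔ Ideal.span {z}) ^ i * (I ⊔ Ideal.span {z}) ^ (n - i) := by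
      rw [mul_assoc, ← pow_add, Nat.add_sub_cancel' (by omega)]
    rw [e]
    refine Ideal.mul_mem_mul ?_
      (Ideal.pow_mem_pow (Ideal.mem_sup_right (Ideal.mem_span_singleton_self z)) _)
    have := ha _ hi
    rw [pow_succ'] at this
    exact Ideal.mul_mono_right (Ideal.pow_right_mono le_sup_left _) this
  · rintro ⟨n, hn⟩
    have key : ∀ n : ℕ, ∀ y ∈ I * (I ⊔ Ideal.span {z}) ^ n, ∃ a : ℕ → T,
        (∀ i ∈ Finset.Icc 1 (n + 1), a i ∈ I ^ i) ∧
          y = ∑ i ∈ Finset.Icc 1 (n + 1), a i * z ^ (n + 1 - i) := by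
      intro n
      induction n with
      | zero =>
        intro y hy
        exact ⟨fun _ => y, by simpa using hy, by simp⟩
      | succ n ih =>
        intro y hy
        rw [pow_succ, ← mul_assoc] at hy
        refine Submodule.mul_induction_on hy (fun m hm k hk => ?_) (fun y y' hy hy' => ?_)
        · obtain ⟨a, ha, rfl⟩ := ih m hm
          obtain ⟨u, hu, v, hv, rfl⟩ := Submodule.mem_sup.1 hk
          obtain ⟨r, rfl⟩ := Ideal.mem_span_singleton'.1 hv
          refine ⟨fun i => (if i = n + 2 then 0 else a i * r) +
              (if i = 1 then 0 else a (i - 1) * u),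
            fun i hi => add_mem ?_ ?_, ?_⟩
          · split_ifs with h
            · exact zero_mem _
            · exact Ideal.mul_mem_right _ _ (ha i (by simp at hi ⊢; omega))
          · split_ifs with h
            · exact zero_mem _
            · have := Ideal.mul_mem_mul (ha (i - 1) (by simp at hi ⊢; omega)) hu
              rwa [← pow_succ, Nat.sub_add_cancel (by simp at hi; omega)] at this
          · simp only [add_mul, Finset.sum_add_distrib, mul_add]
            rw [add_comm]
            congr 1
            · rw [Finset.sum_Icc_succ_top (by omega : 1 ≤ n + 1 + 1)]
              simp only [if_true, zero_mul, add_zero, Finset.sum_mul]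
              refine Finset.sum_congr rfl fun i hi => ?_
              have := (Finset.mem_Icc.1 hi).2
              rw [if_neg (by omega), show n + 1 + 1 - i = (n + 1 - i) + 1 by omega]
              ring
            · rw [← Finset.add_sum_Ioc_eq_sum_Icc (by omega : 1 ≤ n + 1 + 1)]
              simp only [if_true, zero_mul, zero_add, Finset.sum_mul]
              symm
              refine Finset.sum_bij (fun i _ => i - 1) (fun i hi => ?_) (fun i hi j hj h => ?_)
                (fun i hi => ⟨i + 1, ?_, ?_⟩) (fun i hi => ?_)
              · simp at hi ⊢; omega
              · simp at hi hj h; omega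
              · simp at hi ⊢; omega
              · simp
              · simp only [Finset.mem_Ioc] at hi
                rw [if_neg (by omega), show n + 1 - (i - 1) = n + 1 + 1 - i by omega]
                ring
        · obtain ⟨a, ha, rfl⟩ := hy
          obtain ⟨a', ha', rfl⟩ := hy'
          exact ⟨a + a', fun i hi => add_mem (ha i hi) (ha' i hi), by
            simp [add_mul, Finset.sum_add_distrib]⟩
    obtain ⟨a, ha, h⟩ := key n _ hn
    refine ⟨n + 1, by omega, fun i => - a i, fun i hi => neg_mem (ha i hi), ?_⟩
    simp [h]

/-- In a valuation ring, an element that is integral over an ideal is a multiple of an element of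
this ideal. -/
theorem exists_dvd_of_pow_mem {V : Type*} [CommRing V] [IsDomain V] [ValuationRing V]
    (φ : T →+* V) {I : Ideal T} {z : T} {n : ℕ} (h : z ^ (n + 1) ∈ I * (I ⊔ Ideal.span {z}) ^ n) :
    ∃ b ∈ I, φ b ∣ φ z := by
  by_contra! hcon
  have hz : φ z ≠ 0 := fun h0 => hcon 0 (zero_mem _) (by simp [h0])
  have hI : ∀ b ∈ I, φ b ∈ Ideal.span {φ z} * maximalIdeal V := by
    intro b hb
    obtain ⟨y, hy⟩ := (ValuationRing.dvd_total (φ b) (φ z)).resolve_left (hcon b hb)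
    rw [hy]
    refine Ideal.mul_mem_mul (Ideal.mem_span_singleton_self _) ((mem_maximalIdeal _).2 fun hu => ?_)
    obtain ⟨u, rfl⟩ := hu
    exact hcon b hb ⟨↑u⁻¹, by rw [hy]; simp⟩
  have h1 : (I ⊔ Ideal.span {z}).map φ ≤ Ideal.span {φ z} := by
    rw [Ideal.map_sup, Ideal.map_span, Set.image_singleton]
    refine sup_le (Ideal.map_le_iff_le_comap.2 fun b hb => ?_) le_rfl
    exact Ideal.mem_comap.2 (Ideal.mul_le_left (hI b hb))
  have h2 : φ z ^ (n + 1) ∈ Ideal.span {φ z ^ (n + 1)} * maximalIdeal V := by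
    have := Ideal.mem_map_of_mem φ h
    rw [map_pow, Ideal.map_mul, Ideal.map_pow] at this
    refine (?_ : _ ≤ Ideal.span {φ z ^ (n + 1)} * maximalIdeal V) this
    rw [pow_succ', ← Ideal.span_singleton_mul_span_singleton, mul_right_comm,
      ← Ideal.span_singleton_pow]
    exact Ideal.mul_mono (Ideal.map_le_iff_le_comap.2 hI) (Ideal.pow_right_mono h1 n)
  rw [mul_comm, Ideal.mem_mul_span_singleton] at h2
  obtain ⟨m, hm, hm1⟩ := h2
  have : m = 1 := mul_right_cancel₀ (pow_ne_zero (n + 1) hz) (by rw [hm1, one_mul])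
  exact (Ideal.ne_top_iff_one _).1 (maximalIdeal.isMaximal V).ne_top (this ▸ hm)

/-- Transitivity of integral dependence: if the image of each element of `S` is integral over `J`,
then so is the image of each element that is integral over the ideal generated by `S`. -/
theorem MemIntegralClosure.map_of_span {T' : Type*} [CommRing T'] [IsLocalRing T'] (f : T →+* T')
    {S : Set T} {J : Ideal T'} (hS : ∀ s ∈ S, MemIntegralClosure J (f s)) {z : T}
    (hz : MemIntegralClosure (Ideal.span S) z) : MemIntegralClosure J (f z) := by
  obtain ⟨n, hn⟩ := memIntegralClosure_iff.1 hz
  rw [memIntegralClosure_iff]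
  obtain ⟨g, hg, m, hm⟩ := exists_mul_pow_mem_of_valuationRing J (f z) (maximalIdeal T') (by
    intro K _ V φ _ _
    obtain ⟨b, hb, hbz⟩ := exists_dvd_of_pow_mem (φ.comp f) hn
    suffices H : ∃ b' ∈ J, φ b' ∣ φ (f b) by
      obtain ⟨b', hb', h⟩ := H
      exact ⟨b', hb', h.trans hbz⟩
    clear hbz
    induction hb using Submodule.span_induction with
    | mem s hs =>
      obtain ⟨k, hk⟩ := memIntegralClosure_iff.1 (hS s hs)
      exact exists_dvd_of_pow_mem φ hk
    | zero => exact ⟨0, zero_mem _, by simp⟩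
    | add x y _ _ hx hy =>
      obtain ⟨b, hb, hbx⟩ := hx
      obtain ⟨c, hc, hcy⟩ := hy
      rw [map_add, map_add]
      rcases ValuationRing.dvd_total (φ b) (φ c) with h | h
      · exact ⟨b, hb, dvd_add hbx (h.trans hcy)⟩
      · exact ⟨c, hc, dvd_add (h.trans hbx) hcy⟩
    | smul r x _ hx =>
      obtain ⟨b, hb, hbx⟩ := hx
      exact ⟨b, hb, by rw [smul_eq_mul, map_mul, map_mul]; exact hbx.mul_left _⟩)
  refine ⟨m, ?_⟩
  have hu : IsUnit g := by simpa using hg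
  exact (Ideal.unit_mul_mem_iff_mem _ hu).1 hm

theorem MemIntegralClosure.mono {I J : Ideal T} (h : I ≤ J) {z : T}
    (hz : MemIntegralClosure I z) : MemIntegralClosure J z := by
  obtain ⟨n, hn, a, ha, e⟩ := hz
  exact ⟨n, hn, a, fun i hi => Ideal.pow_right_mono h i (ha i hi), e⟩

theorem memIntegralClosure_of_mem {I : Ideal T} {z : T} (hz : z ∈ I) : MemIntegralClosure I z :=
  memIntegralClosure_iff.2 ⟨0, by simpa using hz⟩

end IntegralClosure

/-! ### Differentials and transcendence degree -/

section Transcendence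

open KaehlerDifferential TensorProduct

variable {F K : Type*} [Field F] [Field K] [Algebra F K]

open scoped IntermediateField.algebraAdjoinAdjoin in
/-- In characteristic zero, the differentials of a transcendence basis form a basis of the module
of differentials of a field extension: the extension is formally étale over a polynomial ring. -/
theorem exists_basis_kaehlerDifferential [CharZero F] {ι : Type*} {v : ι → K}
    (hv : IsTranscendenceBasis F v) :
    ∃ b : Module.Basis ι K Ω[K⁄F], ∀ i, b i = D F K (v i) := by
  let A := MvPolynomial ι F
  let P := Algebra.adjoin F (Set.range v)
  let E := IntermediateField.adjoin F (Set.range v)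
  let e : A ≃ₐ[F] P := hv.1.aevalEquiv
  let : Algebra A P := e.toRingEquiv.toRingHom.toAlgebra
  have hAP : ∀ p, algebraMap A P p = e p := fun _ => rfl
  let : Algebra A K := (MvPolynomial.aeval v : A →ₐ[F] K).toRingHom.toAlgebra
  have hAK : ∀ p, algebraMap A K p = MvPolynomial.aeval v p := fun _ => rfl
  have : IsScalarTower F A K := IsScalarTower.of_algebraMap_eq fun r => by
    rw [hAK, MvPolynomial.algebraMap_eq, MvPolynomial.aeval_C]
  have : IsScalarTower A P K := IsScalarTower.of_algebraMap_eq fun p => by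
    rw [hAP, hAK]
    exact (hv.1.algebraMap_aevalEquiv p).symm
  have : Algebra.FormallyEtale A P :=
    Algebra.FormallyEtale.of_equiv
      (AlgEquiv.ofBijective (Algebra.ofId A P) e.bijective)
  have : Algebra.FormallyEtale P K := by
    have : Algebra.FormallyEtale P E := .of_isLocalization (nonZeroDivisors P)
    have : Algebra.IsAlgebraic E K := hv.isAlgebraic_field
    have : Algebra.FormallyEtale E K := .of_isSeparable E K
    exact .comp P E K
  have : Algebra.FormallyEtale A K := Algebra.FormallyEtale.comp A P K
  let b := ((mvPolynomialBasis F ι).baseChange K).map (tensorKaehlerEquivOfFormallyEtale F A K)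
  refine ⟨b, fun i => ?_⟩
  rw [Module.Basis.map_apply, Module.Basis.baseChange_apply, mvPolynomialBasis_apply,
    tensorKaehlerEquivOfFormallyEtale_apply, mapBaseChange_tmul, one_smul, map_D, hAK,
    MvPolynomial.aeval_X]

/-- In characteristic zero, the transcendence degree is at most the number of generators of the
module of differentials. -/
theorem trdeg_le_card_of_span [CharZero F] {τ : Type*} [Fintype τ] (w : τ → Ω[K⁄F])
    (hw : Submodule.span K (Set.range w) = ⊤) : Algebra.trdeg F K ≤ Fintype.card τ := by
  obtain ⟨s, hs⟩ := exists_isTranscendenceBasis F K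
  obtain ⟨b, -⟩ := exists_basis_kaehlerDifferential hs
  classical
  have : Module.Finite K Ω[K⁄F] := ⟨Finset.univ.image w, by simpa using hw⟩
  rw [← hs.cardinalMk_eq_trdeg, b.mk_eq_rank'', ← Module.finrank_eq_rank, Nat.cast_le,
    ← finrank_top, ← hw]
  exact finrank_range_le_card w

/-- Elements of a local domain whose residues are algebraically independent stay algebraically
independent when a nonzero element of the maximal ideal is added. -/
theorem algebraicIndependent_option_of_residue {V ι : Type*} [CommRing V] [IsDomain V]
    [IsLocalRing V] [Algebra F V] {u : ι → V}
    (hu : AlgebraicIndependent F fun i => residue V (u i)) {t : V} (ht : t ∈ maximalIdeal V)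
    (ht0 : t ≠ 0) : AlgebraicIndependent F fun o : Option ι => o.elim t u := by
  have hu' : AlgebraicIndependent F u :=
    AlgebraicIndependent.of_comp (IsScalarTower.toAlgHom F V (ResidueField V)) hu
  rw [AlgebraicIndependent.option_iff_transcendental hu']
  rintro ⟨p, hp0, hp⟩
  -- dividing by a power of the variable, the constant term may be assumed to be nonzero
  obtain ⟨q, hq, hq0⟩ := Polynomial.exists_eq_pow_rootMultiplicity_mul_and_not_dvd p hp0 0
  rw [map_zero, sub_zero] at hq hq0
  have hqt : Polynomial.aeval t q = 0 := by
    rw [hq, map_mul, map_pow, Polynomial.aeval_X] at hp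
    exact (mul_eq_zero.1 hp).resolve_left (pow_ne_zero _ ht0)
  rw [Polynomial.X_dvd_iff] at hq0
  have hmem : ((q.coeff 0 : Algebra.adjoin F (Set.range u)) : V) ∈ maximalIdeal V := by
    have h := Polynomial.divX_mul_X_add q
    rw [← h, map_add, map_mul, Polynomial.aeval_X, Polynomial.aeval_C] at hqt
    have h2 : ((q.coeff 0 : Algebra.adjoin F (Set.range u)) : V) =
        - (Polynomial.aeval t q.divX * t) := eq_neg_of_add_eq_zero_right hqt
    rw [h2]
    exact neg_mem (Ideal.mul_mem_left _ _ ht)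
  obtain ⟨P, hP⟩ := hu'.aevalEquiv.surjective (q.coeff 0)
  have hP' : MvPolynomial.aeval u P = ((q.coeff 0 : Algebra.adjoin F (Set.range u)) : V) := by
    rw [← hP]; exact (hu'.algebraMap_aevalEquiv P).symm
  have hP0 : P = 0 := by
    refine (show Function.Injective (MvPolynomial.aeval fun i => residue V (u i)) from hu) ?_
    rw [map_zero, ← (residue_eq_zero_iff _).2 hmem, ← hP']
    exact MvPolynomial.aeval_algebraMap_apply (B := ResidueField V) u P
  exact hq0 (by rw [← hP, hP0, map_zero])

/-- An exchange argument: modulo the elements of a set `C`, the transcendence degree of a set `G`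
of generators is attained by a subset of `G`. -/
theorem exists_algebraicIndependent_subset (G C : Set K) :
    ∃ B ⊆ G, AlgebraicIndependent F ((↑) : B → K) ∧
      ∀ T ⊆ (Algebra.adjoin F (G ∪ C) : Set K), AlgebraicIndependent F ((↑) : T → K) →
        T.encard ≤ B.encard + C.encard := by
  let M := AlgebraicIndependent.matroid F K
  obtain ⟨B, hB⟩ := M.exists_isBasis G
  refine ⟨B, hB.subset, hB.indep, fun T hT hTi => ?_⟩
  have hcl : (Algebra.adjoin F (G ∪ C) : Set K) ⊆ M.closure (B ∪ C) := by
    have h1 : G ∪ C ⊆ M.closure (B ∪ C) := by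
      refine Set.union_subset (hB.subset_closure.trans (M.closure_subset_closure
        Set.subset_union_left)) ?_
      exact Set.subset_union_right.trans (M.subset_closure _)
    have h2 := AlgebraicIndependent.matroid_closure_eq (R := F) (s := B ∪ C)
    have h3 : Algebra.adjoin F (G ∪ C) ≤
        (Subalgebra.algebraicClosure (Algebra.adjoin F (B ∪ C)) K).restrictScalars F := by
      refine Algebra.adjoin_le ?_
      rw [h2] at h1
      exact h1
    rw [h2]
    exact h3
  calc T.encard ≤ M.eRk (M.closure (B ∪ C)) :=
        Matroid.Indep.encard_le_eRk_of_subset hTi (hT.trans hcl)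
    _ = M.eRk (B ∪ C) := M.eRk_closure_eq _
    _ ≤ (B ∪ C).encard := M.eRk_le_encard _
    _ ≤ _ := Set.encard_union_le _ _

end Transcendence

/-! ### Minors with a generic additional row -/

section Valuative

open KaehlerDifferential

/-- In a valuation ring, a finite nonempty family has a member that divides all the others. -/
theorem exists_forall_dvd {V ι : Type*} [CommRing V] [IsDomain V] [ValuationRing V] [Finite ι]
    [Nonempty ι] (f : ι → V) : ∃ i, ∀ j, f i ∣ f j := by
  classical
  cases nonempty_fintype ι
  suffices H : ∀ s : Finset ι, s.Nonempty → ∃ i, ∀ j ∈ s, f i ∣ f j by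
    obtain ⟨i, hi⟩ := H Finset.univ Finset.univ_nonempty
    exact ⟨i, fun j => hi j (Finset.mem_univ j)⟩
  intro s hs
  induction hs using Finset.Nonempty.cons_induction with
  | singleton a => exact ⟨a, by simp⟩
  | cons a s ha hs ih =>
    obtain ⟨i, hi⟩ := ih
    rcases ValuationRing.dvd_total (f a) (f i) with h | h
    · exact ⟨a, by simpa using fun j hj => h.trans (hi j hj)⟩
    · exact ⟨i, by simpa [h] using hi⟩

/-- If the columns of `M` are combinations of the columns `c`, then bordering the minor at `c` by
one more row and one more column multiplies it by the defect of the last column. -/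
theorem det_snoc_eq {V : Type*} [CommRing V] {k N : ℕ} (M : Fin k → Fin N → V) (a : Fin N → V)
    (c : Fin k → Fin N) (μ : Fin k → V) (j : Fin N) (h : ∀ r, M r j = ∑ i, M r (c i) * μ i) :
    (Matrix.of fun r s : Fin (k + 1) =>
      (Fin.snoc M a : Fin (k + 1) → Fin N → V) r ((Fin.snoc c j : Fin (k + 1) → Fin N) s)).det =
      (Matrix.of fun r s => M r (c s)).det * (a j - ∑ i, a (c i) * μ i) := by
  let e : Fin k ⊕ Fin 1 ≃ Fin (k + 1) := finSumFinEquiv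
  rw [← Matrix.det_submatrix_equiv_self e]
  have h1 : (Matrix.of fun r s : Fin (k + 1) =>
      (Fin.snoc M a : Fin (k + 1) → Fin N → V) r
        ((Fin.snoc c j : Fin (k + 1) → Fin N) s)).submatrix e e =
      Matrix.fromBlocks (Matrix.of fun r s => M r (c s)) 0 (Matrix.of fun _ s => a (c s))
        (Matrix.of fun _ _ => a j - ∑ i, a (c i) * μ i) *
      Matrix.fromBlocks 1 (Matrix.of fun i _ => μ i) 0 1 := by
    rw [Matrix.fromBlocks_multiply]
    have el (i : Fin k) : e (Sum.inl i) = i.castSucc := rfl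
    have er (i : Fin 1) : e (Sum.inr i) = Fin.last k := by
      rw [Subsingleton.elim i 0]; rfl
    ext (r | r) (s | s)
    · simp [el]
    · simp [el, er, Matrix.mul_apply, h]
    · simp [el, er]
    · simp [er, Matrix.mul_apply]
  rw [h1, Matrix.det_mul, Matrix.det_fromBlocks_zero₁₂, Matrix.det_fromBlocks_zero₂₁]
  simp

variable {F : Type*} [Field F] [CharZero F]

/-- The differentials `D (x j)` with `j` outside the columns of a nonvanishing minor of relations
generate the module of differentials, together with `D a'`, which bounds the transcendence
degree. -/
theorem trdeg_le_of_relations {κ σ : Type*} [Field κ] [Algebra F κ] [Fintype σ] {k N : ℕ}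
    (a' : σ → κ) (x : Fin N → κ) (M : Fin k → Fin N → κ)
    (hspan : Submodule.span κ
      (Set.range (fun s => D F κ (a' s)) ∪ Set.range (fun i => D F κ (x i))) = ⊤)
    (hrel : ∀ r, ∑ i, M r i • D F κ (x i) ∈ Submodule.span κ (Set.range fun s => D F κ (a' s)))
    (c : Fin k → Fin N) (hc : (Matrix.of fun r s => M r (c s)).det ≠ 0) :
    Algebra.trdeg F κ ≤ (Fintype.card σ + (N - k) : ℕ) := by
  classical
  have hcinj : Function.Injective c := by
    intro i j hij
    by_contra hne
    exact hc (Matrix.det_zero_of_column_eq hne fun r => by simp [hij])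
  let w : σ ⊕ {j // j ∉ Set.range c} → Ω[κ⁄F] :=
    Sum.elim (fun s => D F κ (a' s)) (fun j => D F κ (x j))
  let W := Submodule.span κ (Set.range w)
  have haW : ∀ s, D F κ (a' s) ∈ W := fun s => Submodule.subset_span ⟨Sum.inl s, rfl⟩
  have hxW' : ∀ j ∉ Set.range c, D F κ (x j) ∈ W := fun j hj =>
    Submodule.subset_span ⟨Sum.inr ⟨j, hj⟩, rfl⟩
  have hxc : ∀ s, D F κ (x (c s)) ∈ W := by
    let A : Matrix (Fin k) (Fin k) κ := Matrix.of fun r s => M r (c s)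
    have h1 : ∀ r, ∑ s, A r s • D F κ (x (c s)) ∈ W := by
      intro r
      have h2 : ∑ i, M r i • D F κ (x i) ∈ W :=
        Submodule.span_le.2 (by rintro _ ⟨s, rfl⟩; exact haW s) (hrel r)
      rw [← Finset.sum_filter_add_sum_filter_not Finset.univ (fun i => i ∈ Set.range c)] at h2
      have h3 := (Submodule.add_mem_iff_left W (Submodule.sum_mem W fun i hi =>
        W.smul_mem _ (hxW' i (Finset.mem_filter.1 hi).2))).1 h2
      convert h3 using 1
      refine Finset.sum_bij (fun s _ => c s) (fun s _ => by simp) (fun s _ s' _ h => hcinj h)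
        (fun i hi => ?_) (fun s _ => rfl)
      obtain ⟨s, rfl⟩ := (Finset.mem_filter.1 hi).2
      exact ⟨s, Finset.mem_univ s, rfl⟩
    intro s
    have h4 : ∑ r, A.adjugate s r • ∑ s', A r s' • D F κ (x (c s')) ∈ W :=
      Submodule.sum_mem W fun r _ => W.smul_mem _ (h1 r)
    have h5 : ∑ r, A.adjugate s r • ∑ s', A r s' • D F κ (x (c s')) =
        A.det • D F κ (x (c s)) := by
      simp_rw [Finset.smul_sum, smul_smul]
      rw [Finset.sum_comm]
      simp_rw [← Finset.sum_smul, ← Matrix.mul_apply, Matrix.adjugate_mul, Matrix.smul_apply,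
        Matrix.one_apply]
      simp
    rw [h5] at h4
    exact (W.smul_mem_iff hc).1 h4
  have hW : W = ⊤ := by
    rw [← top_le_iff, ← hspan, Submodule.span_le]
    rintro _ (⟨s, rfl⟩ | ⟨i, rfl⟩)
    · exact haW s
    · by_cases hi : i ∈ Set.range c
      · obtain ⟨s, rfl⟩ := hi; exact hxc s
      · exact hxW' i hi
  refine (trdeg_le_card_of_span w hW).trans ?_
  rw [Nat.cast_le, Fintype.card_sum, Fintype.card_subtype_compl]
  have : Fintype.card {j // j ∈ Set.range c} = k := by
    refine (Fintype.card_congr (Equiv.ofInjective c hcinj)).symm.trans (Fintype.card_fin k)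
  rw [this, Fintype.card_fin]

/-- Let `V` be a valuation ring, `κ` a subfield of its field of fractions that is generated, on the
level of differentials over the ground field, by elements `a'` and by elements `x` of the maximal
ideal, and let the rows of `M` be relations between the differentials of `x` modulo those of `a'`.
If the residues of `a'` and of the entries of a further row `a` are algebraically independent, then
the nonzero minors of `M` are multiples of minors bordered by the row `a`. -/
theorem exists_minor_dvd {K : Type u} [Field K] [Algebra F K] (V : ValuationSubring K)
    [Algebra F V] [IsScalarTower F V K] (κ : IntermediateField F K) {σ : Type*} [Fintype σ]
    {k N : ℕ} (hkN : k < N) (a' : σ → V) (a x : Fin N → V) (M : Fin k → Fin N → V)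
    (ha' : ∀ s, (a' s : K) ∈ κ) (hx : ∀ i, (x i : K) ∈ κ) (hM : ∀ r i, (M r i : K) ∈ κ)
    (hind : AlgebraicIndependent F fun s : σ ⊕ Fin N => residue V (Sum.elim a' a s))
    (hxm : ∀ i, x i ∈ maximalIdeal V)
    (hspan : Submodule.span κ
      (Set.range (fun s => D F κ ⟨_, ha' s⟩) ∪ Set.range (fun i => D F κ ⟨_, hx i⟩)) = ⊤)
    (hrel : ∀ r, ∑ i, (⟨_, hM r i⟩ : κ) • D F κ ⟨_, hx i⟩ ∈
      Submodule.span κ (Set.range fun s => D F κ ⟨_, ha' s⟩))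
    (c : Fin k → Fin N) (hc : (Matrix.of fun r s => M r (c s)).det ≠ 0) :
    ∃ c' : Fin (k + 1) → Fin N, (Matrix.of fun r s : Fin (k + 1) =>
      (Fin.snoc M a : Fin (k + 1) → Fin N → V) r (c' s)).det ∣
        (Matrix.of fun r s => M r (c s)).det := by
  classical
  have : Nonempty (Fin k → Fin N) := ⟨c⟩
  obtain ⟨d, hd⟩ := exists_forall_dvd
    fun c : Fin k → Fin N => (Matrix.of fun r s => M r (c s)).det
  have hd0 : (Matrix.of fun r s => M r (d s)).det ≠ 0 := fun h0 => by
    have h1 : (Matrix.of fun r s => M r (d s)).det ∣ (Matrix.of fun r s => M r (c s)).det := hd c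
    rw [h0, zero_dvd_iff] at h1
    exact hc h1
  -- the minors at `d` divide all others, so that Cramer's rule has coefficients `μ` in `V`
  choose μ hμ using fun (i : Fin k) (j : Fin N) => hd (Function.update d i j)
  have hcramer : ∀ r j, M r j = ∑ i, M r (d i) * μ i j := by
    intro r j
    have h1 := congrFun (Matrix.mulVec_cramer (Matrix.of fun r s => M r (d s)) fun r => M r j) r
    have h2 : ∀ i, Matrix.cramer (Matrix.of fun r s => M r (d s)) (fun r => M r j) i =
        (Matrix.of fun r s => M r (d s)).det * μ i j := by
      intro i
      rw [← hμ i j, Matrix.cramer_apply]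
      congr 1
      ext r s
      rcases eq_or_ne s i with rfl | hs
      · simp
      · simp [hs]
    rw [Matrix.mulVec, dotProduct] at h1
    simp only [h2, Pi.smul_apply, smul_eq_mul, Matrix.of_apply] at h1
    refine mul_left_cancel₀ hd0 ?_
    rw [← h1, Finset.mul_sum]
    exact Finset.sum_congr rfl fun i _ => by ring
  have hdet : ∀ c : Fin k → Fin N, ((Matrix.of fun r s => M r (c s)).det : K) ∈ κ := by
    intro c
    have h := RingHom.map_det V.subtype (Matrix.of fun r s => M r (c s))
    change ((Matrix.of fun r s => M r (c s)).det : K) = _ at h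
    rw [h, Matrix.det_apply]
    refine sum_mem fun τ _ => ?_
    rw [Units.smul_def, zsmul_eq_mul]
    refine mul_mem (κ.intCast_mem _) (prod_mem fun i _ => ?_)
    exact hM _ _
  have hμκ : ∀ i j, (μ i j : K) ∈ κ := by
    intro i j
    have h := congrArg (V.subtype) (hμ i j)
    rw [map_mul] at h
    have h0 : V.subtype (Matrix.of fun r s => M r (d s)).det ≠ 0 := by
      simpa using hd0
    have h1 : (μ i j : K) = V.subtype (Matrix.of fun r s => M r (Function.update d i j s)).det /
        V.subtype (Matrix.of fun r s => M r (d s)).det := by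
      rw [h, mul_div_cancel_left₀ _ h0]; rfl
    rw [h1]
    exact div_mem (hdet _) (hdet _)
  by_contra! hcon
  have hmem : ∀ j, a j - ∑ i, a (d i) * μ i j ∈ maximalIdeal V := by
    intro j
    rw [mem_maximalIdeal]
    intro hu
    refine hcon (Fin.snoc d j) ?_
    rw [det_snoc_eq M a d (fun i => μ i j) j fun r => hcramer r j]
    exact (IsUnit.mul_right_dvd hu).2 (hd c)
  -- the residues of `a` are combinations of those of `G` and of the `k` elements `a (d i)`
  let G : Set V := Set.range a' ∪ Set.range fun p : Fin k × Fin N => μ p.1 p.2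
  have hGκ : ∀ g ∈ G, (g : K) ∈ κ := by
    rintro _ (⟨s, rfl⟩ | ⟨p, rfl⟩)
    · exact ha' s
    · exact hμκ _ _
  have hGfin : G.Finite := (Set.finite_range _).union (Set.finite_range _)
  let C : Set (ResidueField V) := Set.range fun i => residue V (a (d i))
  obtain ⟨B, hBG, hBi, hB⟩ := exists_algebraicIndependent_subset (F := F) (residue V '' G) C
  let T : Set (ResidueField V) := Set.range fun s : σ ⊕ Fin N => residue V (Sum.elim a' a s)
  have hTcard := hB T (by
    rintro _ ⟨s | j, rfl⟩
    · exact Algebra.subset_adjoin (Or.inl ⟨a' s, Or.inl ⟨s, rfl⟩, rfl⟩)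
    · have h1 : residue V (a j) = ∑ i, residue V (a (d i)) * residue V (μ i j) := by
        have := (residue_eq_zero_iff _).2 (hmem j)
        rw [map_sub, sub_eq_zero] at this
        rw [this, map_sum]
        exact Finset.sum_congr rfl fun i _ => map_mul _ _ _
      simp only [Sum.elim_inr, SetLike.mem_coe]
      rw [h1]
      exact sum_mem fun i _ => mul_mem (Algebra.subset_adjoin (Or.inr ⟨i, rfl⟩))
        (Algebra.subset_adjoin (Or.inl ⟨μ i j, Or.inr ⟨(i, j), rfl⟩, rfl⟩)))
    hind.to_subtype_range
  have hTc : ((Fintype.card σ + N : ℕ) : ℕ∞) ≤ T.encard := by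
    have := hind.injective.encard_range
    rwa [ENat.card_eq_coe_fintype_card, Fintype.card_sum, Fintype.card_fin] at this
  have hCc : C.encard ≤ k := by
    have := Set.encard_image_le (fun i => residue V (a (d i))) Set.univ
    rwa [Set.image_univ, Set.encard_univ, ENat.card_eq_coe_fintype_card, Fintype.card_fin] at this
  have hBfin : B.Finite := (hGfin.image _).subset hBG
  have hNB : Fintype.card σ + N ≤ B.ncard + k := by
    rw [← hBfin.cast_ncard_eq] at hTcard
    exact_mod_cast hTc.trans (hTcard.trans (add_le_add_right hCc _))
  choose v hvG hv using fun b : B => hBG b.2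
  have hvi : AlgebraicIndependent F fun b => residue V (v b) := by
    simp only [hv]; exact hBi
  -- an independent family in `V` whose members lie in `κ` is bounded by the degree of `κ`
  have hcount : ∀ {ι : Type u} [Fintype ι] (w : ι → V), (∀ i, (w i : K) ∈ κ) →
      AlgebraicIndependent F w → ∀ m : ℕ, Algebra.trdeg F κ ≤ m → Fintype.card ι ≤ m := by
    intro ι _ w hw hwi m hm
    have h1 : AlgebraicIndependent F (IsScalarTower.toAlgHom F V K ∘ w) :=
      hwi.map' (IsFractionRing.injective V K)
    have h2 : AlgebraicIndependent F fun i => (⟨(w i : K), hw i⟩ : κ) :=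
      AlgebraicIndependent.of_comp κ.val h1
    have h3 := h2.cardinalMk_le_trdeg.trans hm
    rw [Cardinal.mk_fintype] at h3
    exact_mod_cast h3
  have : Fintype B := hBfin.fintype
  have hBcard : Fintype.card B = B.ncard := by rw [Set.ncard_eq_toFinset_card', Set.toFinset_card]
  by_cases hx0 : ∃ i, x i ≠ 0
  · -- the centre of `V` is not the generic point: the residues lose one degree
    obtain ⟨i, hi⟩ := hx0
    have h1 := hcount (fun o : Option B => o.elim (x i) v)
      (by rintro (_ | b); exacts [hx i, hGκ _ (hvG b)])
      (algebraicIndependent_option_of_residue hvi (hxm i) hi) (Fintype.card σ + (N - k))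
      (trdeg_le_of_relations _ _ _ hspan hrel d fun h0 => hd0 ?_)
    · rw [Fintype.card_option, hBcard] at h1
      omega
    · have h2 := RingHom.map_det (κ.val : κ →+* K)
        (Matrix.of fun r s => (⟨(M r (d s) : K), hM r (d s)⟩ : κ))
      rw [h0, map_zero] at h2
      have h3 := RingHom.map_det V.subtype (Matrix.of fun r s => M r (d s))
      exact Subtype.ext (h3.trans h2.symm)
  · -- `κ` is generated by `a'`, up to algebraic extensions
    push Not at hx0
    have h1 := hcount v (fun b => hGκ _ (hvG b))
      (AlgebraicIndependent.of_comp (IsScalarTower.toAlgHom F V (ResidueField V)) hvi)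
      (Fintype.card σ) (trdeg_le_card_of_span (fun s => D F κ ⟨_, ha' s⟩) ?_)
    · rw [hBcard] at h1
      omega
    · rw [← top_le_iff, ← hspan, Submodule.span_le]
      rintro _ (hs | ⟨i, rfl⟩)
      · exact Submodule.subset_span hs
      · have : (⟨(x i : K), hx i⟩ : κ) = 0 := Subtype.ext (by simp [hx0 i])
        simp [this]

end Valuative

/-! ### Linear sections with generic coefficients -/

section Generic

open KaehlerDifferential

/-- The differentials of generators of a field extension generate the module of differentials. -/
theorem span_D_adjoin {F K : Type*} [Field F] [Field K] [Algebra F K] (S : Set K) :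
    Submodule.span (IntermediateField.adjoin F S)
      (Set.range fun s : S => D F (IntermediateField.adjoin F S)
        ⟨s, IntermediateField.subset_adjoin F S s.2⟩) = ⊤ := by
  rw [← top_le_iff, ← KaehlerDifferential.span_range_derivation, Submodule.span_le]
  rintro _ ⟨⟨y, hy⟩, rfl⟩
  induction hy using IntermediateField.adjoin_induction with
  | mem y hy => exact Submodule.subset_span ⟨⟨y, hy⟩, rfl⟩
  | algebraMap r =>
    have := Derivation.map_algebraMap (D F (IntermediateField.adjoin F S)) r
    exact this ▸ zero_mem _
  | add y z hy hz ihy ihz =>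
    have := map_add (D F (IntermediateField.adjoin F S)) ⟨y, hy⟩ ⟨z, hz⟩
    exact this ▸ add_mem ihy ihz
  | mul y z hy hz ihy ihz =>
    have := Derivation.leibniz (D F (IntermediateField.adjoin F S)) ⟨y, hy⟩ ⟨z, hz⟩
    exact this ▸ add_mem (Submodule.smul_mem _ _ ihz) (Submodule.smul_mem _ _ ihy)
  | inv y hy ihy =>
    have := Derivation.leibniz_inv (D F (IntermediateField.adjoin F S)) ⟨y, hy⟩
    exact this ▸ Submodule.smul_mem _ _ ihy

variable {R : Type u} [CommRing R]

theorem sub_algebraMap_mem_maximalIdeal [IsLocalRing R] [Algebra ℂ R]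
    (hres : Function.Surjective (algebraMap ℂ (ResidueField R))) (r : R) :
    ∃ t : ℂ, r - algebraMap ℂ R t ∈ maximalIdeal R := by
  obtain ⟨t, ht⟩ := hres (residue R r)
  refine ⟨t, (residue_eq_zero_iff _).1 ?_⟩
  rw [map_sub, ← ht]
  exact sub_self _

theorem exists_eq_sum_of_mem_maximalIdeal [IsLocalRing R] {N : ℕ} {x : Fin N → maximalIdeal R}
    (hx : Submodule.span R (Set.range x) = ⊤) {y : R} (hy : y ∈ maximalIdeal R) :
    ∃ b : Fin N → R, y = ∑ i, b i * x i := by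
  have h : (⟨y, hy⟩ : maximalIdeal R) ∈ Submodule.span R (Set.range x) := hx ▸ Submodule.mem_top
  obtain ⟨b, hb⟩ := (Submodule.mem_span_range_iff_exists_fun R).1 h
  refine ⟨b, ?_⟩
  have := congrArg (fun m : maximalIdeal R => (m : R)) hb
  simpa using this.symm

/-- By Nakayama's lemma, the differentials of generators of the maximal ideal generate the module
of differentials of a local ring with residue field `ℂ`. -/
theorem span_D_eq_top [IsLocalRing R] [Algebra ℂ R] [Algebra.EssFiniteType ℂ R]
    (hres : Function.Surjective (algebraMap ℂ (ResidueField R))) {N : ℕ}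
    {x : Fin N → maximalIdeal R} (hx : Submodule.span R (Set.range x) = ⊤) :
    Submodule.span R (Set.range fun i => D ℂ R (x i : R)) = ⊤ := by
  rw [← top_le_iff]
  refine Submodule.le_of_le_smul_of_le_jacobson_bot (I := maximalIdeal R) Module.Finite.fg_top
    (maximalIdeal_le_jacobson ⊥) ?_
  nth_rw 1 [← KaehlerDifferential.span_range_derivation ℂ R]
  rw [Submodule.span_le]
  rintro _ ⟨r, rfl⟩
  obtain ⟨t, ht⟩ := sub_algebraMap_mem_maximalIdeal hres r
  obtain ⟨b, hb⟩ := exists_eq_sum_of_mem_maximalIdeal hx ht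
  have h1 : D ℂ R r = ∑ i, b i • D ℂ R (x i : R) + ∑ i, (x i : R) • D ℂ R (b i) := by
    have h2 := congrArg (D ℂ R) hb
    rw [map_sub, Derivation.map_algebraMap, sub_zero, map_sum] at h2
    rw [h2, ← Finset.sum_add_distrib]
    exact Finset.sum_congr rfl fun i _ => Derivation.leibniz _ _ _
  rw [h1]
  refine add_mem (Submodule.mem_sup_left ?_) (Submodule.mem_sup_right ?_)
  · exact sum_mem fun i _ => Submodule.smul_mem _ _ (Submodule.subset_span ⟨i, rfl⟩)
  · exact sum_mem fun i _ => Submodule.smul_mem_smul (x i).2 trivial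

/-- A row of the Jacobian matrix of a linear section: a relation between the differentials of the
coordinates, or the coefficients of one of the linear forms. -/
def sectionRow {A : Type*} [CommRing A] {c N : ℕ} (f : R →+* A) (α : Fin c × Fin N → A) :
    (Fin N → R) ⊕ Fin c → Fin N → A :=
  Sum.elim (fun v i => f (v i)) (fun j i => α (j, i))

/-- The ideal generated by the maximal minors of `M` bordered by the row `b`. -/
def borderedMinors {A : Type*} [CommRing A] {k N : ℕ} (M : Fin k → Fin N → A) (b : Fin N → A) :
    Ideal A :=
  Ideal.span (Set.range fun c' : Fin (k + 1) → Fin N => (Matrix.of fun r s : Fin (k + 1) =>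
    (Fin.snoc M b : Fin (k + 1) → Fin N → A) r (c' s)).det)

theorem map_det_snoc {A B : Type*} [CommRing A] [CommRing B] {k N : ℕ} (M : Fin k → Fin N → A)
    (b : Fin N → A) (f : A →+* B) (c' : Fin (k + 1) → Fin N) :
    f (Matrix.of fun r s : Fin (k + 1) =>
      (Fin.snoc M b : Fin (k + 1) → Fin N → A) r (c' s)).det =
    (Matrix.of fun r s : Fin (k + 1) => (Fin.snoc (fun r i => f (M r i)) (fun i => f (b i)) :
        Fin (k + 1) → Fin N → B) r (c' s)).det := by
  rw [RingHom.map_det]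
  congr 1
  ext r s
  refine Fin.lastCases ?_ (fun r => ?_) r <;> simp

theorem map_borderedMinors {A B : Type*} [CommRing A] [CommRing B] {k N : ℕ}
    (M : Fin k → Fin N → A) (b : Fin N → A) (f : A →+* B) :
    (borderedMinors M b).map f = borderedMinors (fun r i => f (M r i)) (fun i => f (b i)) := by
  rw [borderedMinors, borderedMinors, Ideal.map_span, ← Set.range_comp]
  congr 2
  funext c'
  exact map_det_snoc M b f c'

theorem map_sectionRow {A B : Type*} [CommRing A] [CommRing B] {c N : ℕ} (f : R →+* A)
    (α : Fin c × Fin N → A) (g : A →+* B) (ρ : (Fin N → R) ⊕ Fin c) (i : Fin N) :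
    g (sectionRow f α ρ i) = sectionRow (g.comp f) (fun s => g (α s)) ρ i := by
  rcases ρ with v | j <;> rfl

/-- The valuative form of the generic Bertini statement: a nonzero minor of the Jacobian matrix of
the section by `c` generic hyperplanes is a multiple of a minor bordered by the coefficients of one
more generic hyperplane, in every valuation ring centred at the generic point over `P`. -/
theorem exists_bordered_minor_dvd [IsLocalRing R] [Algebra ℂ R] [Algebra.EssFiniteType ℂ R]
    (hres : Function.Surjective (algebraMap ℂ (ResidueField R))) {N : ℕ}
    {x : Fin N → maximalIdeal R} (hx : Submodule.span R (Set.range x) = ⊤) {c k : ℕ}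
    {K : Type u} [Field K] (V : ValuationSubring K)
    (Φ : MvPolynomial (Fin (c + 1) × Fin N) R →+* V)
    (hΦ : ∀ f, Φ f ∈ maximalIdeal V ↔ MvPolynomial.map (residue R) f = 0)
    (hΦa : ∀ j : Fin c, Φ (∑ i, MvPolynomial.X (j.castSucc, i) * MvPolynomial.C (x i : R)) = 0)
    (hkN : k < N) (ρ : Fin k → (Fin N → R) ⊕ Fin c)
    (hρ : ∀ r v, ρ r = Sum.inl v → v ∈ relations (R := R) fun i => D ℂ R (x i : R))
    (d : Fin k → Fin N)
    (hd : (Matrix.of fun r s => Φ (sectionRow MvPolynomial.C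
      (fun s => MvPolynomial.X (s.1.castSucc, s.2)) (ρ r) (d s))).det ≠ 0) :
    ∃ c' : Fin (k + 1) → Fin N, (Matrix.of fun r s : Fin (k + 1) =>
      (Fin.snoc (fun r i => Φ (sectionRow MvPolynomial.C
        (fun s => MvPolynomial.X (s.1.castSucc, s.2)) (ρ r) i))
        (fun i => Φ (MvPolynomial.X (Fin.last c, i))) : Fin (k + 1) → Fin N → V) r (c' s)).det ∣
      (Matrix.of fun r s => Φ (sectionRow MvPolynomial.C
        (fun s => MvPolynomial.X (s.1.castSucc, s.2)) (ρ r) (d s))).det := by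
  let S := MvPolynomial (Fin (c + 1) × Fin N) R
  let : Algebra ℂ V := (Φ.comp (algebraMap ℂ S)).toAlgebra
  let : Algebra ℂ K := (V.subtype.comp (Φ.comp (algebraMap ℂ S))).toAlgebra
  have : IsScalarTower ℂ V K := IsScalarTower.of_algebraMap_eq fun _ => rfl
  let : Algebra R K := (V.subtype.comp (Φ.comp MvPolynomial.C)).toAlgebra
  have hRK : ∀ r, algebraMap R K r = (Φ (MvPolynomial.C r) : K) := fun _ => rfl
  let a' : Fin c × Fin N → V := fun s => Φ (MvPolynomial.X (s.1.castSucc, s.2))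
  let G : Set K := Set.range (algebraMap R K) ∪ Set.range fun s => (a' s : K)
  let κ := IntermediateField.adjoin ℂ G
  have hRκ : ∀ r, algebraMap R K r ∈ κ := fun r =>
    IntermediateField.subset_adjoin ℂ G (Or.inl ⟨r, rfl⟩)
  have ha'κ : ∀ s, (a' s : K) ∈ κ := fun s =>
    IntermediateField.subset_adjoin ℂ G (Or.inr ⟨s, rfl⟩)
  let : Algebra R κ := ((algebraMap R K).codRestrict κ.toSubring hRκ).toAlgebra
  have : IsScalarTower ℂ R κ := IsScalarTower.of_algebraMap_eq fun _ => rfl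
  have hRκ' : ∀ r, algebraMap R κ r = ⟨algebraMap R K r, hRκ r⟩ := fun _ => rfl
  -- the differential of an element of `R` is a combination of those of the coordinates
  have hmap : ∀ v : Fin N → R,
      map ℂ ℂ R κ (∑ i, v i • D ℂ R (x i : R)) =
        ∑ i, algebraMap R κ (v i) • D ℂ κ (algebraMap R κ (x i)) := by
    intro v
    simp [map_sum, map_smul, map_D]
  have hspan : Submodule.span κ (Set.range (fun s => D ℂ κ ⟨_, ha'κ s⟩) ∪
      Set.range (fun i => D ℂ κ ⟨_, hRκ (x i : R)⟩)) = ⊤ := by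
    rw [← top_le_iff, ← span_D_adjoin G, Submodule.span_le]
    rintro _ ⟨⟨_, ⟨r, rfl⟩ | ⟨s, rfl⟩⟩, rfl⟩
    · have h1 : D ℂ R r ∈ Submodule.span R (Set.range fun i => D ℂ R (x i : R)) := by
        rw [span_D_eq_top hres hx]; trivial
      obtain ⟨v, hv⟩ := (Submodule.mem_span_range_iff_exists_fun R).1 h1
      have h2 := hmap v
      rw [hv, map_D] at h2
      change D ℂ κ (algebraMap R κ r) ∈ Submodule.span κ _
      rw [h2]
      exact sum_mem fun i _ => Submodule.smul_mem _ _ (Submodule.subset_span (Or.inr ⟨i, rfl⟩))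
    · exact Submodule.subset_span (Or.inl ⟨s, rfl⟩)
  let M : Fin k → Fin N → V := fun r i => Φ (sectionRow MvPolynomial.C
    (fun s => MvPolynomial.X (s.1.castSucc, s.2)) (ρ r) i)
  have hM : ∀ r i, (M r i : K) ∈ κ := by
    intro r i
    change (Φ _ : K) ∈ κ
    rcases ρ r with v | j
    · exact hRκ (v i)
    · exact ha'κ (j, i)
  have hrel : ∀ r, ∑ i, (⟨_, hM r i⟩ : κ) • D ℂ κ ⟨_, hRκ (x i : R)⟩ ∈
      Submodule.span κ (Set.range fun s => D ℂ κ ⟨_, ha'κ s⟩) := by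
    intro r
    rcases hr : ρ r with v | j
    · have h1 := hmap v
      rw [mem_relations.1 (hρ r v hr), map_zero] at h1
      have h2 : ∀ i, (⟨_, hM r i⟩ : κ) = algebraMap R κ (v i) := fun i => Subtype.ext (by
        simp only [M, hr]; rfl)
      simp only [h2]
      exact h1 ▸ zero_mem _
    · have h2 : ∀ i, (⟨_, hM r i⟩ : κ) = ⟨_, ha'κ (j, i)⟩ := fun i => Subtype.ext (by
        simp only [M, hr]; rfl)
      simp only [h2]
      have h3 : ∑ i, (⟨_, ha'κ (j, i)⟩ : κ) * ⟨_, hRκ (x i : R)⟩ = 0 := by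
        refine Subtype.ext ?_
        have h4 := congrArg (V.subtype) (hΦa j)
        rw [map_sum, map_sum, map_zero] at h4
        rw [AddSubmonoidClass.coe_finsetSum]
        rw [ZeroMemClass.coe_zero, ← h4]
        refine Finset.sum_congr rfl fun i _ => ?_
        rw [map_mul, map_mul]
        rfl
      have h5 := congrArg (D ℂ κ) h3
      rw [map_zero, map_sum] at h5
      simp only [Derivation.leibniz] at h5
      rw [Finset.sum_add_distrib] at h5
      rw [eq_neg_of_add_eq_zero_left h5]
      exact neg_mem (sum_mem fun i _ => Submodule.smul_mem _ _
        (Submodule.subset_span ⟨(j, i), rfl⟩))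
  -- `V` is centred at `𝔪 R[X]`, whose residue field is the field of rational functions over `ℂ`
  have hind : AlgebraicIndependent ℂ fun s : Fin (c + 1) × Fin N =>
      residue V (Φ (MvPolynomial.X s)) := by
    rw [algebraicIndependent_iff]
    have h0 : ∀ p : MvPolynomial (Fin (c + 1) × Fin N) ℂ,
        residue V (Φ (MvPolynomial.map (algebraMap ℂ R) p)) =
        MvPolynomial.aeval (fun s => residue V (Φ (MvPolynomial.X s))) p := by
      intro p
      induction p using MvPolynomial.induction_on with
      | C t => simp; rfl
      | add p q hp hq => simp only [map_add, hp, hq]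
      | mul_X p s hp => simp only [map_mul, hp, MvPolynomial.map_X, MvPolynomial.aeval_X]
    intro p hp
    have h1 := h0 p
    rw [hp, residue_eq_zero_iff, hΦ, MvPolynomial.map_map] at h1
    refine MvPolynomial.map_injective ((residue R).comp (algebraMap ℂ R)) (RingHom.injective _) ?_
    rw [h1, map_zero]
  refine exists_minor_dvd V κ hkN a' (fun i => Φ (MvPolynomial.X (Fin.last c, i)))
    (fun i => Φ (MvPolynomial.C (x i : R))) M ha'κ (fun i => hRκ (x i : R)) hM ?_ ?_ hspan hrel d hd
  · have h1 := hind.comp (Sum.elim (fun s : Fin c × Fin N => (s.1.castSucc, s.2))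
      (fun i : Fin N => (Fin.last c, i))) ?_
    · have h2 : (fun s => residue V (Sum.elim a'
          (fun i => Φ (MvPolynomial.X (Fin.last c, i))) s)) =
          (fun s => residue V (Φ (MvPolynomial.X s))) ∘ Sum.elim
            (fun s : Fin c × Fin N => (s.1.castSucc, s.2)) (fun i : Fin N => (Fin.last c, i)) := by
        funext s
        rcases s with s | i <;> rfl
      rw [h2]
      exact h1
    · rintro (⟨j, i⟩ | i) (⟨j', i'⟩ | i') h
      · simpa using h
      · simp only [Sum.elim_inl, Sum.elim_inr, Prod.mk.injEq] at h
        exact absurd h.1 (Fin.castSucc_lt_last j).ne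
      · simp only [Sum.elim_inl, Sum.elim_inr, Prod.mk.injEq] at h
        exact absurd h.1.symm (Fin.castSucc_lt_last j').ne
      · simpa using h
  · intro i
    rw [hΦ, MvPolynomial.map_C, (residue_eq_zero_iff _).2 (x i).2, map_zero]

end Generic

/-! ### Linear sections with general coefficients -/

section General

open KaehlerDifferential

variable {R : Type u} [CommRing R]

/-- A minor of the Jacobian matrix of a linear section is integral over the minors bordered by
the coefficients of one more linear form, if the coefficients of the forms are general. -/
theorem exists_memIntegralClosure_borderedMinors [IsLocalRing R] [Algebra ℂ R]
    [Algebra.EssFiniteType ℂ R]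
    (hres : Function.Surjective (algebraMap ℂ (ResidueField R))) {N : ℕ}
    {x : Fin N → maximalIdeal R} (hx : Submodule.span R (Set.range x) = ⊤) {c k : ℕ}
    (hkN : k < N) (ρ : Fin k → (Fin N → R) ⊕ Fin c)
    (hρ : ∀ r v, ρ r = Sum.inl v → v ∈ relations (R := R) fun i => D ℂ R (x i : R))
    (d : Fin k → Fin N) :
    ∃ P : MvPolynomial (Fin (c + 1) × Fin N) ℂ, P ≠ 0 ∧ ∀ a, MvPolynomial.eval a P ≠ 0 →
      ∀ {A : Type u} [CommRing A] (f : R →+* A),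
        (∀ j : Fin c, f (∑ i, a (j.castSucc, i) • (x i : R)) = 0) →
        MemIntegralClosure
          (borderedMinors (fun r i => sectionRow f
            (fun s => f (algebraMap ℂ R (a (s.1.castSucc, s.2)))) (ρ r) i)
            (fun i => f (algebraMap ℂ R (a (Fin.last c, i)))))
          (Matrix.of fun r s => sectionRow f
            (fun s => f (algebraMap ℂ R (a (s.1.castSucc, s.2)))) (ρ r) (d s)).det := by
  let S := MvPolynomial (Fin (c + 1) × Fin N) R
  let 𝔭 : Ideal S := RingHom.ker (MvPolynomial.map (σ := Fin (c + 1) × Fin N) (residue R))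
  have : 𝔭.IsPrime := RingHom.ker_isPrime _
  let ℓ : Fin c → S := fun j =>
    ∑ i, MvPolynomial.X (j.castSucc, i) * MvPolynomial.C (x i : R)
  let 𝔞 : Ideal S := Ideal.span (Set.range ℓ)
  have h𝔞 : 𝔞 ≤ 𝔭 := by
    refine Ideal.span_le.2 ?_
    rintro _ ⟨j, rfl⟩
    change MvPolynomial.map (residue R) (ℓ j) = 0
    simp only [ℓ, map_sum, map_mul, MvPolynomial.map_X, MvPolynomial.map_C]
    refine Finset.sum_eq_zero fun i _ => ?_
    rw [(residue_eq_zero_iff _).2 (x i).2, map_zero, mul_zero]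
  let π : S →+* S ⧸ 𝔞 := Ideal.Quotient.mk 𝔞
  have hπ : Function.Surjective π := Ideal.Quotient.mk_surjective
  have hker : RingHom.ker π ≤ 𝔭 := by rw [Ideal.mk_ker]; exact h𝔞
  have : (𝔭.map π).IsPrime := Ideal.map_isPrime_of_surjective hπ hker
  have hcomap : (𝔭.map π).comap π = 𝔭 := by
    rw [Ideal.comap_map_of_surjective' _ hπ, sup_eq_left.2 hker]
  let M : Fin k → Fin N → S := fun r i => sectionRow MvPolynomial.C
    (fun s => MvPolynomial.X (s.1.castSucc, s.2)) (ρ r) i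
  let b : Fin N → S := fun i => MvPolynomial.X (Fin.last c, i)
  let z : S := (Matrix.of fun r s => M r (d s)).det
  -- integral dependence holds after multiplication by `g`, a unit at general coefficients
  obtain ⟨g, hg, n, hn⟩ := exists_mul_pow_mem_of_valuationRing ((borderedMinors M b).map π) (π z)
    (𝔭.map π) (by
      intro K _ V φ hφ hz
      have hmap : ∀ y : S, φ (π y) ∈ maximalIdeal V ↔ MvPolynomial.map (residue R) y = 0 := by
        intro y
        rw [← Ideal.mem_comap, hφ, ← Ideal.mem_comap, hcomap]
        rfl
      have hΦz : φ (π z) = (Matrix.of fun r s => (φ.comp π) (M r (d s))).det := by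
        change (φ.comp π) z = _
        rw [RingHom.map_det]
        rfl
      rw [hΦz] at hz ⊢
      obtain ⟨c', hc'⟩ := exists_bordered_minor_dvd hres hx V (φ.comp π) hmap
        (fun j => by
          have : π (ℓ j) = 0 := Ideal.Quotient.eq_zero_iff_mem.2 (Ideal.subset_span ⟨j, rfl⟩)
          change φ (π (ℓ j)) = 0
          rw [this, map_zero]) hkN ρ hρ d hz
      refine ⟨_, Ideal.mem_map_of_mem π (Ideal.subset_span ⟨c', rfl⟩), ?_⟩
      change (φ.comp π) _ ∣ _
      rw [map_det_snoc]
      exact hc')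
  obtain ⟨g, rfl⟩ := hπ g
  have hg0 : MvPolynomial.map (residue R) g ≠ 0 := fun h => hg (Ideal.mem_map_of_mem π h)
  obtain ⟨P, hP⟩ := MvPolynomial.map_surjective (σ := Fin (c + 1) × Fin N) _ hres
    (MvPolynomial.map (residue R) g)
  refine ⟨P, ?_, ?_⟩
  · rintro rfl
    exact hg0 (by rw [← hP, map_zero])
  intro a ha A _ f hf
  let ev : S →+* A := MvPolynomial.eval₂Hom f fun s => f (algebraMap ℂ R (a s))
  have hevC : ∀ r, ev (MvPolynomial.C r) = f r := fun r => MvPolynomial.eval₂Hom_C _ _ _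
  have hevX : ∀ s, ev (MvPolynomial.X s) = f (algebraMap ℂ R (a s)) :=
    fun s => MvPolynomial.eval₂Hom_X' _ _ _
  have hev : ∀ y ∈ 𝔞, ev y = 0 := by
    intro y hy
    have : 𝔞 ≤ RingHom.ker ev := by
      refine Ideal.span_le.2 ?_
      rintro _ ⟨j, rfl⟩
      change ev (ℓ j) = 0
      rw [← hf j]
      simp only [ℓ, map_sum, map_mul, hevC, hevX, Algebra.smul_def]
    exact this hy
  let θ : S ⧸ 𝔞 →+* A := Ideal.Quotient.lift 𝔞 ev hev
  have hθ : ∀ y, θ (π y) = ev y := fun y => Ideal.Quotient.lift_mk _ _ _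
  have hunit : IsUnit (ev g) := by
    have h1 : ev = f.comp (MvPolynomial.eval fun s => algebraMap ℂ R (a s)) := by
      refine MvPolynomial.ringHom_ext (fun r => ?_) (fun s => ?_)
      · rw [hevC]; simp
      · rw [hevX]; simp
    rw [h1]
    refine IsUnit.map f ?_
    rw [← residue_ne_zero_iff_isUnit]
    intro h0
    refine ha ?_
    have h2 : residue R (MvPolynomial.eval (fun s => algebraMap ℂ R (a s)) g) =
        MvPolynomial.eval (fun s => residue R (algebraMap ℂ R (a s)))
          (MvPolynomial.map (residue R) g) := by
      rw [MvPolynomial.map_eval]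
      rfl
    have h3 : algebraMap ℂ (ResidueField R) (MvPolynomial.eval a P) =
        MvPolynomial.eval (fun s => residue R (algebraMap ℂ R (a s)))
          (MvPolynomial.map (residue R) g) := by
      rw [← hP, MvPolynomial.map_eval]
      rfl
    refine (algebraMap ℂ (ResidueField R)).injective ?_
    rw [h3, ← h2, h0, map_zero]
  have hM : ∀ r i, ev (M r i) = sectionRow f
      (fun s => f (algebraMap ℂ R (a (s.1.castSucc, s.2)))) (ρ r) i := by
    intro r i
    rw [map_sectionRow]
    rcases ρ r with v | j
    · exact hevC _
    · exact hevX _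
  have hI : ((borderedMinors M b).map π).map θ = borderedMinors (fun r i => sectionRow f
      (fun s => f (algebraMap ℂ R (a (s.1.castSucc, s.2)))) (ρ r) i)
        (fun i => f (algebraMap ℂ R (a (Fin.last c, i)))) := by
    rw [Ideal.map_map, map_borderedMinors]
    congr 1
    · funext r i
      exact (hθ _).trans (hM r i)
    · funext i
      exact (hθ _).trans (hevX _)
  have hz : θ (π z) = (Matrix.of fun r s => sectionRow f
      (fun s => f (algebraMap ℂ R (a (s.1.castSucc, s.2)))) (ρ r) (d s)).det := by
    rw [hθ, RingHom.map_det]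
    congr 1
    ext r s
    exact hM r (d s)
  have h := Ideal.mem_map_of_mem θ hn
  rw [Ideal.map_mul, Ideal.map_pow, Ideal.map_sup, Ideal.map_span, Set.image_singleton, hI,
    map_mul, map_pow, hz, hθ] at h
  exact memIntegralClosure_iff.2 ⟨n, (Ideal.unit_mul_mem_iff_mem _ hunit).1 h⟩

end General

/-! ### Differentials and dimension of a linear section -/

section Section

open KaehlerDifferential TensorProduct

/-- For a surjection `A → B`, the kernel of `M → B ⊗[A] M`. -/
theorem mem_ker_smul_top_of_one_tmul_eq_zero {A B M : Type*} [CommRing A] [CommRing B]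
    [Algebra A B] [AddCommGroup M] [Module A M] (h : Function.Surjective (algebraMap A B)) {ξ : M}
    (hξ : (1 : B) ⊗ₜ[A] ξ = 0) : ξ ∈ RingHom.ker (algebraMap A B) • (⊤ : Submodule A M) := by
  have hex := rTensor_exact M (LinearMap.exact_subtype_ker_map (Algebra.linearMap A B)) h
  obtain ⟨t, ht⟩ := (hex ((1 : A) ⊗ₜ[A] ξ)).1 (by
    rw [LinearMap.rTensor_tmul, ← hξ, Algebra.linearMap_apply, map_one])
  have hξt : ξ = TensorProduct.lid A M (LinearMap.rTensor M (Submodule.subtype _) t) := by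
    rw [ht, TensorProduct.lid_tmul, one_smul]
  rw [hξt]
  clear ht hξt
  induction t with
  | zero => rw [map_zero, map_zero]; exact zero_mem _
  | tmul r m =>
    rw [LinearMap.rTensor_tmul, TensorProduct.lid_tmul]
    exact Submodule.smul_mem_smul r.2 trivial
  | add t t' ht ht' => rw [map_add, map_add]; exact add_mem ht ht'

/-- The conormal sequence of a surjection, for single differentials. -/
theorem exists_sub_D_mem_of_map_eq_zero {F A B : Type*} [CommRing F] [CommRing A] [CommRing B]
    [Algebra F A] [Algebra F B] [Algebra A B] [IsScalarTower F A B]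
    (h : Function.Surjective (algebraMap A B)) {ξ : Ω[A⁄F]} (hξ : map F F A B ξ = 0) :
    ∃ y ∈ RingHom.ker (algebraMap A B),
      ξ - D F A y ∈ RingHom.ker (algebraMap A B) • (⊤ : Submodule A (Ω[A⁄F])) := by
  have h1 : (1 : B) ⊗ₜ[A] ξ ∈ LinearMap.range (kerCotangentToTensor F A B) := by
    rw [KaehlerDifferential.range_kerCotangentToTensor F A B h]
    simpa using hξ
  obtain ⟨y, hy⟩ := h1
  obtain ⟨⟨y, hy'⟩, rfl⟩ := Ideal.toCotangent_surjective _ y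
  rw [kerCotangentToTensor_toCotangent] at hy
  refine ⟨y, hy', mem_ker_smul_top_of_one_tmul_eq_zero h ?_⟩
  rw [tmul_sub, hy, sub_self]

variable {R : Type u} [CommRing R] [IsLocalRing R] [Algebra ℂ R] {N : ℕ}
  {x : Fin N → maximalIdeal R}

/-- The differentials of the coordinates generate the differentials of a quotient. -/
theorem span_D_eq_top_of_surjective
    (hD : Submodule.span R (Set.range fun i => D ℂ R (x i : R)) = ⊤) {A : Type*} [CommRing A]
    [Algebra ℂ A] (f : R →ₐ[ℂ] A) (hf : Function.Surjective f) :
    Submodule.span A (Set.range fun i => D ℂ A (f (x i))) = ⊤ := by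
  let : Algebra R A := f.toRingHom.toAlgebra
  have : IsScalarTower ℂ R A := IsScalarTower.of_algebraMap_eq fun t => (f.commutes t).symm
  rw [← top_le_iff, ← KaehlerDifferential.span_range_derivation, Submodule.span_le]
  rintro _ ⟨y, rfl⟩
  obtain ⟨r, rfl⟩ := hf y
  have h1 : D ℂ R r ∈ Submodule.span R (Set.range fun i => D ℂ R (x i : R)) := hD ▸ trivial
  obtain ⟨v, hv⟩ := (Submodule.mem_span_range_iff_exists_fun R).1 h1
  have h2 := congrArg (map ℂ ℂ R A) hv
  simp only [map_sum, map_smul, map_D] at h2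
  change D ℂ A (algebraMap R A r) ∈ Submodule.span A _
  rw [← h2]
  exact sum_mem fun i _ => by
    rw [← algebraMap_smul A (v i)]
    exact Submodule.smul_mem _ _ (Submodule.subset_span ⟨i, rfl⟩)

theorem D_linear (a : Fin N → ℂ) :
    D ℂ R (∑ i, a i • (x i : R)) = ∑ i, algebraMap ℂ R (a i) • D ℂ R (x i : R) := by
  simp only [map_sum, Derivation.map_smul, algebraMap_smul]

/-- The relations between the differentials of the coordinates on a linear section are generated by
those on the ambient germ and by the coefficients of the linear forms. -/
theorem relations_eq_span_sectionRow
    (hD : Submodule.span R (Set.range fun i => D ℂ R (x i : R)) = ⊤) {m : ℕ}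
    {w : Fin m → Fin N → R} (hw : Submodule.span R (Set.range w) =
      relations (R := R) fun i => D ℂ R (x i : R)) {A : Type*} [CommRing A]
    [Algebra ℂ A] (f : R →ₐ[ℂ] A) (hf : Function.Surjective f) {c : ℕ} (a : Fin c × Fin N → ℂ)
    (hker : RingHom.ker f = linearIdeal x c a) :
    relations (R := A) (fun i => D ℂ A (f (x i))) =
      Submodule.span A (Set.range fun ρ : Fin m ⊕ Fin c => sectionRow f.toRingHom
        (fun s => f (algebraMap ℂ R (a s))) (ρ.map w id)) := by
  let : Algebra R A := f.toRingHom.toAlgebra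
  have : IsScalarTower ℂ R A := IsScalarTower.of_algebraMap_eq fun t => (f.commutes t).symm
  have hmap : ∀ v : Fin N → R, map ℂ ℂ R A (∑ i, v i • D ℂ R (x i : R)) =
      ∑ i, f (v i) • D ℂ A (f (x i)) := by
    intro v
    simp only [map_sum, map_smul, map_D, ← algebraMap_smul A (v _)]
    rfl
  have hker' : RingHom.ker (algebraMap R A) = linearIdeal x c a := hker
  refine le_antisymm ?_ ?_
  · intro b hb
    choose v hv using fun i => hf (b i)
    obtain rfl : (fun i => f (v i)) = b := funext hv
    clear hv
    rw [mem_relations, ← hmap] at hb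
    obtain ⟨y, hy, hξ⟩ := exists_sub_D_mem_of_map_eq_zero hf hb
    -- the differential of an element of the ideal of the section is a combination of those of
    -- the linear forms, modulo the ideal
    have hDy : ∃ r : Fin c → R, D ℂ R y - ∑ j, r j • D ℂ R (∑ i, a (j, i) • (x i : R)) ∈
        RingHom.ker (algebraMap R A) • (⊤ : Submodule R (Ω[R⁄ℂ])) := by
      have hy' := hy
      rw [hker'] at hy'
      obtain ⟨r, rfl⟩ := (Submodule.mem_span_range_iff_exists_fun R).1 hy'
      refine ⟨r, ?_⟩
      rw [map_sum, ← Finset.sum_sub_distrib]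
      refine sum_mem fun j _ => ?_
      rw [smul_eq_mul, Derivation.leibniz, add_sub_cancel_left]
      refine Submodule.smul_mem_smul ?_ trivial
      rw [hker']
      exact Ideal.subset_span ⟨j, rfl⟩
    obtain ⟨r, hr⟩ := hDy
    have h1 := add_mem hξ hr
    rw [← hD, sub_add_sub_cancel] at h1
    have h2 : ∃ e : Fin N → R, (∀ i, f (e i) = 0) ∧ ∑ i, e i • D ℂ R (x i : R) =
        ∑ i, v i • D ℂ R (x i : R) - ∑ j, r j • D ℂ R (∑ i, a (j, i) • (x i : R)) := by
      rw [Submodule.mem_ideal_smul_span_iff_exists_sum] at h1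
      obtain ⟨e, he, hs⟩ := h1
      refine ⟨e, he, ?_⟩
      exact (Finsupp.sum_fintype e (fun i r => r • D ℂ R (x i : R))
        fun i => zero_smul _ _).symm.trans hs
    obtain ⟨e, he, hs⟩ := h2
    have h3 : (fun i => v i - ∑ j, r j * algebraMap ℂ R (a (j, i)) - e i) ∈
        Submodule.span R (Set.range w) := by
      rw [hw, mem_relations]
      simp only [sub_smul, Finset.sum_sub_distrib, hs, D_linear, Finset.sum_smul, mul_smul,
        Finset.smul_sum]
      rw [Finset.sum_comm, sub_self]
    obtain ⟨t, ht⟩ := (Submodule.mem_span_range_iff_exists_fun R).1 h3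
    have h4 : (fun i => f (v i)) = ∑ l, f (t l) • sectionRow f.toRingHom
          (fun s => f (algebraMap ℂ R (a s))) (Sum.map w id (Sum.inl l : Fin m ⊕ Fin c)) +
        ∑ j, f (r j) • sectionRow f.toRingHom
          (fun s => f (algebraMap ℂ R (a s))) (Sum.map w id (Sum.inr j : Fin m ⊕ Fin c)) := by
      funext i
      have h5 := congrArg f (congrFun ht i)
      simp only [Finset.sum_apply, Pi.smul_apply, smul_eq_mul, map_sum, map_mul, map_sub, he,
        sub_zero] at h5
      have h6 := sub_eq_iff_eq_add.1 h5.symm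
      rw [h6]
      simp [sectionRow]
    rw [h4]
    exact add_mem (sum_mem fun l _ => Submodule.smul_mem _ _ (Submodule.subset_span ⟨_, rfl⟩))
      (sum_mem fun l _ => Submodule.smul_mem _ _ (Submodule.subset_span ⟨_, rfl⟩))
  · rw [Submodule.span_le]
    rintro _ ⟨l | j, rfl⟩
    · have h1 : w l ∈ relations (R := R) fun i => D ℂ R (x i : R) :=
        hw ▸ Submodule.subset_span ⟨l, rfl⟩
      rw [mem_relations] at h1
      have h2 := hmap (w l)
      rw [h1, map_zero] at h2
      exact mem_relations.2 h2.symm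
    · have h2 := hmap fun i => algebraMap ℂ R (a (j, i))
      rw [← D_linear, map_D] at h2
      have h3 : algebraMap R A (∑ i, a (j, i) • (x i : R)) = 0 := by
        rw [← RingHom.mem_ker, hker']
        exact Ideal.subset_span ⟨j, rfl⟩
      rw [h3, map_zero] at h2
      exact mem_relations.2 h2.symm

/-- `dimNat` has no junk value on Noetherian local rings. -/
theorem coe_dimNat (A : Type*) [CommRing A] [IsLocalRing A] [IsNoetherianRing A] :
    ((dimNat A : ℕ) : WithBot ℕ∞) = ringKrullDim A := by
  have h1 : ringKrullDim A ≠ ⊤ := ringKrullDim_ne_top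
  have h2 : ringKrullDim A ≠ ⊥ := ringKrullDim_ne_bot
  unfold dimNat
  generalize ringKrullDim A = d at *
  induction d with
  | bot => exact absurd rfl h2
  | coe d =>
    induction d with
    | top => exact absurd rfl h1
    | coe d => rfl

/-- Krull's theorem: one equation lowers the dimension by at most one. -/
theorem dimNat_le_of_surjective {A B : Type*} [CommRing A] [IsLocalRing A] [IsNoetherianRing A]
    [CommRing B] [IsLocalRing B] (h : A →+* B) (hh : Function.Surjective h) (y : A)
    (hy : RingHom.ker h = Ideal.span {y}) (hym : y ∈ maximalIdeal A) :
    dimNat A ≤ dimNat B + 1 := by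
  have h1 : ringKrullDim A ≤ ringKrullDim (A ⧸ Ideal.span {y}) + 1 := by
    have := ringKrullDim_le_ringKrullDim_quotient_add_card {y} (R := A) (by
      simpa [ringJacobson_eq_maximalIdeal] using hym)
    rwa [Finset.coe_singleton, Finset.card_singleton, Nat.cast_one] at this
  have h2 : ringKrullDim (A ⧸ Ideal.span {y}) = ringKrullDim B :=
    ringKrullDim_eq_of_ringEquiv
      ((Ideal.quotEquivOfEq hy.symm).trans (RingHom.quotientKerEquivOfSurjective hh))
  have : IsNoetherianRing B := isNoetherianRing_of_surjective _ _ h hh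
  rw [h2] at h1
  rw [← coe_dimNat A, ← coe_dimNat B] at h1
  exact_mod_cast h1

end Section

/-! ### Adding a general hyperplane -/

section Step

open KaehlerDifferential

theorem ForGeneral.forall {σ ι : Type*} [Finite ι] {p : ι → (σ → ℂ) → Prop}
    (h : ∀ i, ForGeneral (p i)) : ForGeneral fun a => ∀ i, p i a := by
  have := Fintype.ofFinite ι
  choose F hF hFp using h
  refine ⟨∏ i, F i, Finset.prod_ne_zero_iff.2 fun i _ => hF i, fun a ha i => hFp i a fun h0 => ?_⟩
  rw [map_prod] at ha
  exact ha (Finset.prod_eq_zero (Finset.mem_univ i) h0)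

theorem ForGeneral.mono {σ : Type*} {p q : (σ → ℂ) → Prop} (hp : ForGeneral p)
    (h : ∀ a, p a → q a) : ForGeneral q := by
  obtain ⟨F, hF, hFp⟩ := hp
  exact ⟨F, hF, fun a ha => h a (hFp a ha)⟩

theorem ForGeneral.and {σ : Type*} {p q : (σ → ℂ) → Prop} (hp : ForGeneral p)
    (hq : ForGeneral q) : ForGeneral fun a => p a ∧ q a := by
  obtain ⟨F, hF, hFp⟩ := hp
  obtain ⟨G, hG, hGq⟩ := hq
  refine ⟨F * G, mul_ne_zero hF hG, fun a ha => ?_⟩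
  rw [map_mul] at ha
  exact ⟨hFp a (left_ne_zero_of_mul ha), hGq a (right_ne_zero_of_mul ha)⟩

theorem ForGeneral.comp {σ τ : Type*} {p : (σ → ℂ) → Prop} (hp : ForGeneral p) {e : σ → τ}
    (he : Function.Injective e) : ForGeneral fun a : τ → ℂ => p (a ∘ e) := by
  obtain ⟨F, hF, hFp⟩ := hp
  refine ⟨MvPolynomial.rename e F, fun h => hF (MvPolynomial.rename_injective e he
    (h.trans (map_zero _).symm)), fun a ha => hFp _ ?_⟩
  rwa [MvPolynomial.eval_rename] at ha

variable {R : Type u} [CommRing R] [IsLocalRing R] [Algebra ℂ R] {N : ℕ}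
  {x : Fin N → maximalIdeal R}

/-- The Jacobian ideal of a linear section is generated by minors of its Jacobian matrix. -/
theorem jacobianIdeal_eq_rowMinors
    (hD : Submodule.span R (Set.range fun i => D ℂ R (x i : R)) = ⊤) {m : ℕ}
    {w : Fin m → Fin N → R} (hw : Submodule.span R (Set.range w) =
      relations (R := R) fun i => D ℂ R (x i : R)) {A : Type*} [CommRing A]
    [Algebra ℂ A] (f : R →ₐ[ℂ] A) (hf : Function.Surjective f) {c : ℕ} (a : Fin c × Fin N → ℂ)
    (hker : RingHom.ker f = linearIdeal x c a) :
    jacobianIdeal A = rowMinors (Set.range fun ρ : Fin m ⊕ Fin c => sectionRow f.toRingHom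
      (fun s => f (algebraMap ℂ R (a s))) (ρ.map w id)) (N - dimNat A) := by
  rw [jacobianIdeal, fittingIdeal_eq _ (span_D_eq_top_of_surjective hD f hf),
    relations_eq_span_sectionRow hD hw f hf a hker, rowMinors_span]

theorem linearIdeal_succ (c : ℕ) (a : Fin (c + 1) × Fin N → ℂ) :
    linearIdeal x (c + 1) a = linearIdeal x c (fun s => a (s.1.castSucc, s.2)) ⊔
      Ideal.span {∑ i, a (Fin.last c, i) • (x i : R)} := by
  rw [linearIdeal, linearIdeal, ← Ideal.span_union]
  congr 1
  ext y
  constructor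
  · rintro ⟨j, rfl⟩
    refine Fin.lastCases (Or.inr rfl) (fun j => Or.inl ⟨j, rfl⟩) j
  · rintro (⟨j, rfl⟩ | rfl)
    exacts [⟨j.castSucc, rfl⟩, ⟨Fin.last c, rfl⟩]

theorem sum_smul_mem_maximalIdeal (a : Fin N → ℂ) : ∑ i, a i • (x i : R) ∈ maximalIdeal R :=
  Ideal.sum_mem _ fun i _ => by
    rw [Algebra.smul_def]
    exact Ideal.mul_mem_left _ _ (x i).2

/-- One more general hyperplane section does not increase the power of the maximal ideal
needed to get into the integral closure of the Jacobian ideal. The previous section is any ring `A`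
that represents it, so that for `c = 0` one can take `R` itself. -/
theorem forGeneral_maxPowLeJacobian_succ [Algebra.EssFiniteType ℂ R]
    (hres : Function.Surjective (algebraMap ℂ (ResidueField R)))
    (hx : Submodule.span R (Set.range x) = ⊤) (c : ℕ) :
    ForGeneral fun a : Fin (c + 1) × Fin N → ℂ => ∀ {A : Type u} [CommRing A] [IsLocalRing A]
      [Algebra ℂ A] (f : R →ₐ[ℂ] A), Function.Surjective f →
      RingHom.ker f = linearIdeal x c (fun s => a (s.1.castSucc, s.2)) →
      ∀ k, MaxPowLeJacobian A k → MaxPowLeJacobian (LinearSection x (c + 1) a) k := by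
  have hD := span_D_eq_top hres hx
  have : IsNoetherianRing R := Algebra.EssFiniteType.isNoetherianRing (R := ℂ) (S := R)
  obtain ⟨m, w, hw⟩ := Submodule.fg_iff_exists_fin_generating_family.1
    (IsNoetherian.noetherian (relations (R := R) fun i => D ℂ R (x i : R)))
  -- the finitely many choices of generating rows and of columns of a minor
  have hgen := fun t : Σ k : Fin N, (Fin (k : ℕ) → Fin m ⊕ Fin c) × (Fin (k : ℕ) → Fin N) =>
    exists_memIntegralClosure_borderedMinors hres hx t.1.2 (fun r => (t.2.1 r).map w id)
      (fun r v hv => by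
        rcases hr : t.2.1 r with l | j
        · rw [hr, Sum.map_inl, Sum.inl.injEq] at hv
          rw [← hv, ← hw]
          exact Submodule.subset_span ⟨l, rfl⟩
        · rw [hr] at hv
          cases hv) t.2.2
  refine (ForGeneral.forall hgen).mono fun a ha A _ _ _ f hf hker k hk => ?_
  let B := LinearSection x (c + 1) a
  let g : R →ₐ[ℂ] B := Ideal.Quotient.mkₐ ℂ _
  have hg : Function.Surjective g := Ideal.Quotient.mkₐ_surjective ℂ _
  have hkerg : RingHom.ker g = linearIdeal x (c + 1) a := Ideal.Quotient.mkₐ_ker ℂ _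
  let a' : Fin c × Fin N → ℂ := fun s => a (s.1.castSucc, s.2)
  let y : R := ∑ i, a (Fin.last c, i) • (x i : R)
  have hle : RingHom.ker f ≤ RingHom.ker g := by
    rw [hker, hkerg, linearIdeal_succ]
    exact le_sup_left
  let h : A →ₐ[ℂ] B := AlgHom.liftOfSurjective f hf g hle
  have hh : ∀ r, h (f r) = g r := AlgHom.liftOfSurjective_apply f hf g hle
  have hhs : Function.Surjective h := AlgHom.liftOfSurjective_surjective f hf g hle hg
  have hkerh : RingHom.ker h.toRingHom = Ideal.span {f y} := by
    refine le_antisymm ?_ ?_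
    · intro t ht
      obtain ⟨r, rfl⟩ := hf t
      have h1 : r ∈ RingHom.ker g := (hh r).symm.trans ht
      rw [hkerg, linearIdeal_succ] at h1
      obtain ⟨r₁, hr₁, r₂, hr₂, rfl⟩ := Submodule.mem_sup.1 h1
      rw [← hker] at hr₁
      obtain ⟨s, rfl⟩ := Ideal.mem_span_singleton'.1 hr₂
      rw [map_add, (RingHom.mem_ker).1 hr₁, zero_add, map_mul]
      exact Ideal.mul_mem_left _ _ (Ideal.mem_span_singleton_self _)
    · rw [Ideal.span_singleton_le_iff_mem]
      change h (f y) = 0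
      rw [hh, ← RingHom.mem_ker, hkerg, linearIdeal_succ]
      exact Ideal.mem_sup_right (Ideal.mem_span_singleton_self _)
  have : IsNoetherianRing A := isNoetherianRing_of_surjective _ _ f.toRingHom hf
  have hdim : dimNat A ≤ dimNat B + 1 :=
    dimNat_le_of_surjective h.toRingHom hhs _ hkerh (by
      have : IsLocalHom f.toRingHom := IsLocalHom.of_surjective _ hf
      exact map_maximalIdeal_le f.toRingHom (Ideal.mem_map_of_mem _ (sum_smul_mem_maximalIdeal _)))
  have hJA := jacobianIdeal_eq_rowMinors hD hw f hf a' hker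
  have hJB := jacobianIdeal_eq_rowMinors hD hw g hg a hkerg
  have hrow : ∀ (ρ : Fin m ⊕ Fin c) (i : Fin N), h (sectionRow f.toRingHom
      (fun s => f (algebraMap ℂ R (a' s))) (ρ.map w id) i) = sectionRow g.toRingHom
        (fun s => g (algebraMap ℂ R (a' s))) (ρ.map w id) i := by
    rintro (l | j) i
    exacts [hh _, hh _]
  have hrow' : ∀ ρ : Fin m ⊕ Fin c, sectionRow g.toRingHom
        (fun s => g (algebraMap ℂ R (a' s))) (ρ.map w id) ∈ Set.range fun ρ : Fin m ⊕ Fin (c + 1) =>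
      sectionRow g.toRingHom (fun s => g (algebraMap ℂ R (a s))) (ρ.map w id) := by
    rintro (l | j)
    exacts [⟨Sum.inl l, rfl⟩, ⟨Sum.inr j.castSucc, rfl⟩]
  intro z hz
  rw [← map_maximalIdeal_of_surjective h.toRingHom hhs, ← Ideal.map_pow] at hz
  obtain ⟨z, hzA, rfl⟩ := (Ideal.mem_map_iff_of_surjective _ hhs).1 hz
  have hzJ := hk z hzA
  rw [hJA, rowMinors] at hzJ
  refine hzJ.map_of_span h.toRingHom ?_
  rintro _ ⟨M, d, hM, rfl⟩
  choose ρ hρ using hM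
  have hdet : h.toRingHom (Matrix.of fun i j => M i (d j)).det =
      (Matrix.of fun r s => sectionRow g.toRingHom
        (fun s => g (algebraMap ℂ R (a' s))) ((ρ r).map w id) (d s)).det := by
    rw [RingHom.map_det]
    congr 1
    ext r s
    exact (congrArg h (congrFun (hρ r) (d s)).symm).trans (hrow _ _)
  rw [hdet, hJB]
  by_cases hlt : N - dimNat A < N
  · refine MemIntegralClosure.mono ?_ (ha ⟨⟨N - dimNat A, hlt⟩, ρ, d⟩ g.toRingHom fun j => ?_)
    · refine le_trans (Ideal.span_le.2 ?_) (rowMinors_antitone _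
        (by omega : N - dimNat B ≤ N - dimNat A + 1))
      rintro _ ⟨c', rfl⟩
      refine det_mem_rowMinors (Fintype.card_fin _) _ (fun r => ?_) c'
      refine Fin.lastCases ?_ (fun r => ?_) r
      · rw [Fin.snoc_last]
        exact ⟨Sum.inr (Fin.last c), rfl⟩
      · rw [Fin.snoc_castSucc]
        exact hrow' (ρ r)
    · change g _ = 0
      rw [← RingHom.mem_ker, hkerg]
      exact Ideal.subset_span ⟨j.castSucc, rfl⟩
  · -- here the minors of the ambient Jacobian matrix have the full size `N`
    refine memIntegralClosure_of_mem (rowMinors_antitone _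
      (by omega : N - dimNat B ≤ N - dimNat A) ?_)
    exact det_mem_rowMinors (Fintype.card_fin _) _ (fun r => hrow' (ρ r)) d

end Step

/-! ### Dimension and transcendence degree -/

section Dimension

theorem le_height_of_isMaximal_mvPolynomial {F : Type*} [Field F] (s : ℕ)
    (P : Ideal (MvPolynomial (Fin s) F)) [P.IsMaximal] : (s : ℕ∞) ≤ P.height := by
  induction s with
  | zero => simp
  | succ s ih =>
    let e := MvPolynomial.finSuccEquiv F s
    let Q : Ideal (Polynomial (MvPolynomial (Fin s) F)) := P.map e.toRingEquiv
    have hQ : Q.IsMaximal := Ideal.map_isMaximal_of_equiv e.toRingEquiv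
    let p : Ideal (MvPolynomial (Fin s) F) := Q.comap Polynomial.C
    have hp : p.IsMaximal := Polynomial.isMaximal_comap_C_of_isJacobsonRing Q
    have hpQ : Q.LiesOver p := ⟨rfl⟩
    have h1 := Polynomial.height_eq_height_add_one p Q
    have h2 : Q.height = P.height := RingEquiv.height_map e.toRingEquiv P
    rw [← h2, h1, Nat.cast_succ]
    gcongr
    exact ih _

/-- The dimension of a local domain essentially of finite type over a field `F`, with residue
field `F`, is at least the transcendence degree of its field of fractions. -/
theorem exists_isTranscendenceBasis_le_ringKrullDim {F A K : Type*} [Field F] [CommRing A]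
    [IsDomain A] [IsLocalRing A] [Algebra F A] [Algebra.EssFiniteType F A]
    (hres : Function.Surjective (algebraMap F (ResidueField A))) [Field K] [Algebra F K]
    [Algebra A K] [IsScalarTower F A K] [IsFractionRing A K] :
    ∃ (s : ℕ) (v : Fin s → K), IsTranscendenceBasis F v ∧ (s : WithBot ℕ∞) ≤ ringKrullDim A := by
  -- `A` is the localization at a maximal ideal `𝔫` of a finitely generated algebra `B`, which is
  -- integral over a polynomial ring `P`
  let B := Algebra.EssFiniteType.subalgebra F A
  let 𝔫 : Ideal B := (maximalIdeal A).under B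
  have hM : Algebra.EssFiniteType.submonoid F A = 𝔫.primeCompl := by
    ext b
    change IsUnit (algebraMap B A b) ↔ ¬ algebraMap B A b ∈ maximalIdeal A
    rw [mem_maximalIdeal, mem_nonunits_iff, not_not]
  have : IsLocalization.AtPrime A 𝔫 := by
    rw [IsLocalization.AtPrime, ← hM]
    infer_instance
  have h𝔫 : 𝔫.IsMaximal := by
    have h1 : 𝔫 = RingHom.ker ((residue A).comp (algebraMap B A)) := by
      rw [← RingHom.comap_ker, ker_residue]
    rw [h1]
    refine RingHom.ker_isMaximal_of_surjective _ fun t => ?_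
    obtain ⟨r, rfl⟩ := hres t
    exact ⟨algebraMap F B r, rfl⟩
  obtain ⟨s, g, hg, hgi⟩ := exists_integral_inj_algHom_of_fg F B
  let P := MvPolynomial (Fin s) F
  let : Algebra P B := g.toRingHom.toAlgebra
  have : IsScalarTower F P B := IsScalarTower.of_algebraMap_eq fun t => (g.commutes t).symm
  have : Algebra.IsIntegral P B := ⟨hgi⟩
  have : FaithfulSMul P B := (faithfulSMul_iff_algebraMap_injective P B).2 hg
  let : Algebra P K := ((algebraMap B K).comp (algebraMap P B)).toAlgebra
  have : IsScalarTower P B K := IsScalarTower.of_algebraMap_eq fun t => rfl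
  have : IsScalarTower F P K := IsScalarTower.of_algebraMap_eq fun t => by
    rw [IsScalarTower.algebraMap_apply P B K, ← IsScalarTower.algebraMap_apply F P B,
      ← IsScalarTower.algebraMap_apply F B K]
  have : IsFractionRing B K := by
    refine IsFractionRing.of_field B K fun z => ?_
    obtain ⟨a, b, -, rfl⟩ := IsFractionRing.div_surjective A z
    obtain ⟨⟨a₁, a₂⟩, ha⟩ := IsLocalization.surj (Algebra.EssFiniteType.submonoid F A) a
    obtain ⟨⟨b₁, b₂⟩, hb⟩ := IsLocalization.surj (Algebra.EssFiniteType.submonoid F A) b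
    have hunit : ∀ t : Algebra.EssFiniteType.submonoid F A, algebraMap B K t ≠ 0 := fun t => by
      rw [IsScalarTower.algebraMap_apply B A K]
      exact (t.2.map (algebraMap A K)).ne_zero
    have hfrac : ∀ (y : A) (y₁ : B) (y₂ : Algebra.EssFiniteType.submonoid F A),
        y * algebraMap B A y₂ = algebraMap B A y₁ →
        algebraMap A K y = algebraMap B K y₁ / algebraMap B K y₂ := fun y y₁ y₂ h => by
      rw [eq_div_iff (hunit y₂), IsScalarTower.algebraMap_apply B A K,
        IsScalarTower.algebraMap_apply B A K y₁, ← map_mul, h]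
    refine ⟨a₁ * b₂, a₂ * b₁, ?_⟩
    rw [hfrac a a₁ a₂ ha, hfrac b b₁ b₂ hb, div_div_div_eq, map_mul, map_mul]
  have : FaithfulSMul P K := (faithfulSMul_iff_algebraMap_injective P K).2
    ((IsFractionRing.injective B K).comp hg)
  have : Algebra.IsAlgebraic P K := by
    rw [← IsFractionRing.isAlgebraic_iff' P B K]
    infer_instance
  refine ⟨s, _, (IsTranscendenceBasis.mvPolynomial (Fin s) F).algebraMap_comp (A := K), ?_⟩
  have : (𝔫.under P).IsMaximal := Ideal.isMaximal_comap_of_isIntegral_of_isMaximal 𝔫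
  rw [IsLocalization.AtPrime.ringKrullDim_eq_height 𝔫 A]
  have : IsNoetherianRing B := Algebra.FiniteType.isNoetherianRing F B
  have h2 := Ideal.height_eq_height_add_of_liesOver_of_hasGoingDown (𝔫.under P) 𝔫
  have h3 : (s : ℕ∞) ≤ 𝔫.height :=
    (le_height_of_isMaximal_mvPolynomial s (𝔫.under P)).trans (h2 ▸ le_self_add)
  exact_mod_cast h3

end Dimension

/-! ### The Jacobian ideal at smooth points -/

section SmoothRank

open KaehlerDifferential TensorProduct

/-- In characteristic zero, a derivation of a local ring maps nilpotent elements into the maximal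
ideal. -/
theorem derivation_mem_maximalIdeal {F L : Type*} [Field F] [CharZero F] [CommRing L]
    [IsLocalRing L] [Algebra F L] (d : Derivation F L L) {t : L} (ht : IsNilpotent t) :
    d t ∈ maximalIdeal L := by
  rw [mem_maximalIdeal, mem_nonunits_iff]
  intro hu
  have h1 := congrArg d (pow_nilpotencyClass ht)
  have hn : (nilpotencyClass t : F) ≠ 0 := Nat.cast_ne_zero.2 (pos_nilpotencyClass_iff.2 ht).ne'
  rw [Derivation.leibniz_pow, map_zero, nsmul_eq_mul, smul_eq_mul, ← map_natCast (algebraMap F L),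
    (hn.isUnit.map (algebraMap F L)).mul_right_eq_zero, hu.mul_left_eq_zero] at h1
  exact pow_pred_nilpotencyClass ht h1

/-- If the maximal ideal of `L` consists of nilpotent elements and `Ω[L⁄F]` is free, then its rank
is at most the transcendence degree of the residue field. -/
theorem rank_le_card_of_isTranscendenceBasis {F L : Type*} [Field F] [CharZero F] [CommRing L]
    [IsLocalRing L] [Algebra F L] (hnil : ∀ t ∈ maximalIdeal L, IsNilpotent t) {e s : ℕ}
    (b : Module.Basis (Fin e) L Ω[L⁄F]) {v : Fin s → ResidueField L}
    (hv : IsTranscendenceBasis F v) : e ≤ s := by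
  let κ := ResidueField L
  obtain ⟨b', -⟩ := exists_basis_kaehlerDifferential hv
  have hsurj : Function.Surjective (algebraMap L κ) := residue_surjective
  -- nilpotent elements have differentials that vanish over `κ`: no conormal contribution
  have hzero : ∀ t ∈ maximalIdeal L, (1 : κ) ⊗ₜ[L] D F L t = 0 := by
    intro t ht
    rw [← b.sum_repr (D F L t), tmul_sum]
    refine Finset.sum_eq_zero fun i _ => ?_
    have h1 : b.repr (D F L t) i ∈ maximalIdeal L :=
      derivation_mem_maximalIdeal ((b.coord i).compDer (D F L)) (hnil t ht)
    rw [tmul_smul, smul_tmul', Algebra.smul_def, ResidueField.algebraMap_eq,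
      (residue_eq_zero_iff _).2 h1, zero_mul, zero_tmul]
  have hinj : Function.Injective (mapBaseChange F L κ) := by
    rw [← LinearMap.ker_eq_bot, eq_bot_iff]
    intro y hy
    have h1 : y ∈ LinearMap.range (kerCotangentToTensor F L κ) := by
      rw [KaehlerDifferential.range_kerCotangentToTensor F L κ hsurj]
      exact hy
    obtain ⟨t, rfl⟩ := h1
    obtain ⟨⟨t, ht⟩, rfl⟩ := Ideal.toCotangent_surjective _ t
    rw [kerCotangentToTensor_toCotangent]
    exact hzero t ((residue_eq_zero_iff _).1 ht)
  have : Module.Finite κ Ω[κ⁄F] := Module.Finite.of_basis b'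
  have h1 := LinearMap.finrank_le_finrank_of_injective hinj
  have h2 := Module.finrank_eq_card_basis (b.baseChange κ)
  have h3 := Module.finrank_eq_card_basis b'
  rw [Fintype.card_fin] at h2 h3
  rwa [← h2, ← h3]

/-- The rank of the module of differentials at a point where it is free is at most the dimension:
it is computed at a minimal prime `q ≤ p`. -/
theorem rank_le_dimNat {R : Type*} [CommRing R] [IsLocalRing R] [Algebra ℂ R]
    [Algebra.EssFiniteType ℂ R]
    (hres : Function.Surjective (algebraMap ℂ (ResidueField R))) (p : Ideal R) [p.IsPrime] {e : ℕ}
    (b : Module.Basis (Fin e) (Localization.AtPrime p) Ω[Localization.AtPrime p⁄ℂ]) :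
    e ≤ dimNat R := by
  have : IsNoetherianRing R := Algebra.EssFiniteType.isNoetherianRing ℂ R
  obtain ⟨q, hq, hqp⟩ := Ideal.exists_minimalPrimes_le (bot_le (a := p))
  have : q.IsPrime := hq.1.1
  let L := Localization.AtPrime q
  have hpq : p.primeCompl ≤ q.primeCompl := fun r hr hr' => hr (hqp hr')
  let : Algebra (Localization.AtPrime p) L :=
    IsLocalization.localizationAlgebraOfSubmonoidLe _ L p.primeCompl q.primeCompl hpq
  have : IsScalarTower R (Localization.AtPrime p) L :=
    IsLocalization.localization_isScalarTower_of_submonoid_le _ L p.primeCompl q.primeCompl hpq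
  have : IsScalarTower ℂ (Localization.AtPrime p) L := IsScalarTower.of_algebraMap_eq fun t => by
    rw [IsScalarTower.algebraMap_apply ℂ R L,
      IsScalarTower.algebraMap_apply ℂ R (Localization.AtPrime p),
      ← IsScalarTower.algebraMap_apply R _ L]
  have := IsLocalization.isLocalization_of_submonoid_le (Localization.AtPrime p) L p.primeCompl
    q.primeCompl hpq
  let M := q.primeCompl.map (algebraMap R (Localization.AtPrime p))
  let bL : Module.Basis (Fin e) L Ω[L⁄ℂ] := b.ofIsLocalizedModule L M
    (KaehlerDifferential.map ℂ ℂ (Localization.AtPrime p) L)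
  have : Ring.KrullDimLE 0 L := .of_isLocalization _ hq _
  have hloc : IsLocalRing (R ⧸ q) :=
    IsLocalRing.of_surjective' (Ideal.Quotient.mk q) Ideal.Quotient.mk_surjective
  have hresq : Function.Surjective (algebraMap ℂ (ResidueField (R ⧸ q))) := by
    intro y
    obtain ⟨y, rfl⟩ := residue_surjective y
    obtain ⟨r, rfl⟩ := Ideal.Quotient.mk_surjective y
    obtain ⟨t, ht⟩ := sub_algebraMap_mem_maximalIdeal hres r
    refine ⟨t, ?_⟩
    have : IsLocalHom (Ideal.Quotient.mk q) :=
      IsLocalHom.of_surjective _ Ideal.Quotient.mk_surjective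
    have h1 := (residue_eq_zero_iff _).2
      (map_maximalIdeal_le (Ideal.Quotient.mk q) (Ideal.mem_map_of_mem _ ht))
    rw [map_sub, map_sub, sub_eq_zero] at h1
    exact h1.symm
  obtain ⟨s, v, hv, hs⟩ := exists_isTranscendenceBasis_le_ringKrullDim hresq
    (K := q.ResidueField)
  refine (rank_le_card_of_isTranscendenceBasis
    (fun t ht => Ring.KrullDimLE.isNilpotent_iff_mem_maximalIdeal.2 ht) bL hv).trans ?_
  have h1 := hs.trans (ringKrullDim_quotient_le q)
  rw [← coe_dimNat R] at h1
  exact_mod_cast h1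

/-- The Jacobian ideal does not vanish at a smooth point. -/
theorem not_jacobianIdeal_le_of_isSmoothAt {R : Type*} [CommRing R] [IsLocalRing R] [Algebra ℂ R]
    [Algebra.EssFiniteType ℂ R]
    (hres : Function.Surjective (algebraMap ℂ (ResidueField R))) (p : Ideal R) [p.IsPrime]
    [Algebra.IsSmoothAt ℂ p] : ¬ jacobianIdeal R ≤ p := by
  intro hJ
  let Rp := Localization.AtPrime p
  have : Module.Free Rp Ω[Rp⁄ℂ] := Module.free_of_flat_of_isLocalRing
  let b := Module.finBasis Rp Ω[Rp⁄ℂ]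
  have he := rank_le_dimNat hres p b
  obtain ⟨N, g, hg⟩ := Module.Finite.exists_fin (R := R) (M := Ω[R⁄ℂ])
  have hJ' : jacobianIdeal R =
      rowMinors (relations (R := R) g : Set (Fin N → R)) (N - dimNat R) := fittingIdeal_eq g hg _
  let φ := KaehlerDifferential.map ℂ ℂ R Rp
  have hg' : Submodule.span Rp (Set.range (φ ∘ g)) = ⊤ := by
    rw [Set.range_comp]
    exact span_eq_top_of_isLocalizedModule Rp p.primeCompl φ hg
  -- a basis, without relations, computes the same Fitting ideal over `Rp`
  have htop : rowMinors (relations (R := Rp) (φ ∘ g) : Set (Fin N → Rp)) (N - dimNat R) = ⊤ := by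
    rw [← fittingIdeal_eq _ hg', fittingIdeal_eq _ b.span_eq, Nat.sub_eq_zero_of_le he,
      rowMinors_zero]
  -- relations over `Rp` are relations over `R` up to denominators
  have hrel : relations (R := Rp) (φ ∘ g) ≤
      Submodule.span Rp ((fun (v : Fin N → R) i => algebraMap R Rp (v i)) ''
        (relations (R := R) g : Set (Fin N → R))) := by
    intro v hv
    obtain ⟨s, hs⟩ := IsLocalization.exist_integer_multiples_of_finite p.primeCompl v
    choose u hu using hs
    have h1 : φ (∑ i, u i • g i) = 0 := by
      have h2 := congrArg (fun y => (s : R) • y) (mem_relations.1 hv)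
      simp only [smul_zero, Finset.smul_sum] at h2
      rw [map_sum, ← h2]
      refine Finset.sum_congr rfl fun i _ => ?_
      rw [map_smul, ← smul_assoc, ← algebraMap_smul Rp (u i), hu]
      rfl
    obtain ⟨t, ht⟩ := (IsLocalizedModule.eq_zero_iff p.primeCompl φ).1 h1
    have h3 : (fun i => (t : R) * u i) ∈ relations (R := R) g := by
      rw [mem_relations]
      simp only [mul_smul, ← Finset.smul_sum]
      exact ht
    have hst : IsUnit (algebraMap R Rp (t * s : p.primeCompl)) :=
      IsLocalization.map_units Rp (t * s)
    have h4 : v = hst.unit⁻¹.val • (fun i => algebraMap R Rp ((t : R) * u i)) := by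
      funext i
      rw [Pi.smul_apply, smul_eq_mul, map_mul, hu, Algebra.smul_def,
        ← mul_assoc (algebraMap R Rp t),
        ← map_mul, ← mul_assoc]
      rw [← Submonoid.coe_mul, hst.val_inv_mul, one_mul]
    rw [h4]
    exact Submodule.smul_mem _ _ (Submodule.subset_span ⟨_, h3, rfl⟩)
  have hle : rowMinors (relations (R := Rp) (φ ∘ g) : Set (Fin N → Rp)) (N - dimNat R) ≤
      (jacobianIdeal R).map (algebraMap R Rp) := by
    refine (rowMinors_mono hrel _).trans ?_
    rw [rowMinors_span, hJ']
    refine Ideal.span_le.2 ?_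
    rintro _ ⟨A, c, hA, rfl⟩
    choose A' hA' hAA' using hA
    have h1 := Ideal.mem_map_of_mem (algebraMap R Rp)
      (det_mem_rowMinors (Fintype.card_fin _) A' hA' c)
    have h2 : (algebraMap R Rp).mapMatrix (Matrix.of fun i j => A' i (c j)) =
        Matrix.of fun i j => A i (c j) := by
      ext i j
      exact congrFun (hAA' i) (c j)
    rw [RingHom.map_det, h2] at h1
    exact h1
  rw [htop, top_le_iff] at hle
  have h1 := Ideal.map_mono (f := algebraMap R Rp) hJ
  rw [hle, Localization.AtPrime.map_eq_maximalIdeal, top_le_iff] at h1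
  exact (maximalIdeal.isMaximal Rp).ne_top h1

/-- The Jacobian ideal of an isolated singularity is `⊤` or `𝔪`-primary. -/
theorem exists_maxPowLeJacobian {R : Type u} [CommRing R] [IsLocalRing R] [Algebra ℂ R]
    [Algebra.EssFiniteType ℂ R]
    (hres : Function.Surjective (algebraMap ℂ (ResidueField R))) (h : IsIsolatedSingularity R) :
    ∃ k, MaxPowLeJacobian R k := by
  have : IsNoetherianRing R := Algebra.EssFiniteType.isNoetherianRing ℂ R
  have h1 : maximalIdeal R ≤ (jacobianIdeal R).radical := by
    rw [Ideal.radical_eq_sInf]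
    refine le_sInf ?_
    rintro p ⟨hp, hpp⟩
    by_contra hne
    have := h p fun h => hne h.ge
    exact not_jacobianIdeal_le_of_isSmoothAt hres p hp
  obtain ⟨k, hk⟩ := Ideal.exists_pow_le_of_le_radical_of_fg h1 (IsNoetherian.noetherian _)
  exact ⟨k, fun z hz => memIntegralClosure_of_mem (hk hz)⟩

end SmoothRank

/-! ### Comparison of the invariants -/

section Types

variable {R : Type u} [CommRing R] [IsLocalRing R] [Algebra ℂ R]

theorem MaxPowLeJacobian.mono {k l : ℕ} (hkl : k ≤ l) (h : MaxPowLeJacobian R k) :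
    MaxPowLeJacobian R l := fun z hz => h z (Ideal.pow_le_pow_right hkl hz)

theorem linearIdeal_zero {N : ℕ} (x : Fin N → maximalIdeal R) (a : Fin 0 × Fin N → ℂ) :
    linearIdeal x 0 a = ⊥ := by
  rw [linearIdeal, Set.range_eq_empty, Ideal.span_empty]

theorem nu_ne_top {k : ℕ} (h : MaxPowLeJacobian R k) : nu R ≠ ⊤ := by
  have : nu R ≤ (k + 1 : ℕ) := iInf₂_le (k + 1) ⟨Nat.le_add_left 1 k, h⟩
  exact (this.trans_lt (ENat.natCast_lt_top _)).ne

variable [Algebra.EssFiniteType ℂ R]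

theorem forGeneral_nu_le (hres : Function.Surjective (algebraMap ℂ (ResidueField R))) {N : ℕ}
    {x : Fin N → maximalIdeal R} (hx : Submodule.span R (Set.range x) = ⊤) :
    ForGeneral fun a : Fin 1 × Fin N → ℂ => nu (LinearSection x 1 a) ≤ nu R := by
  refine (forGeneral_maxPowLeJacobian_succ hres hx 0).mono fun a ha => ?_
  refine le_iInf₂ fun ν hν => iInf₂_le ν ⟨hν.1, ?_⟩
  refine ha (AlgHom.id ℂ R) Function.surjective_id ?_ (ν - 1) hν.2
  rw [linearIdeal_zero]
  exact (RingHom.injective_iff_ker_eq_bot (AlgHom.id ℂ R)).1 Function.injective_id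

theorem forGeneral_linearSection_succ
    (hres : Function.Surjective (algebraMap ℂ (ResidueField R))) {N : ℕ}
    {x : Fin N → maximalIdeal R} (hx : Submodule.span R (Set.range x) = ⊤) {c k : ℕ}
    (h : ForGeneral fun a : Fin c × Fin N → ℂ => MaxPowLeJacobian (LinearSection x c a) k) :
    ForGeneral fun a : Fin (c + 1) × Fin N → ℂ =>
      MaxPowLeJacobian (LinearSection x (c + 1) a) k := by
  have he : Function.Injective fun s : Fin c × Fin N => (s.1.castSucc, s.2) := by
    rintro ⟨j, i⟩ ⟨j', i'⟩ h
    simpa using h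
  exact ((forGeneral_maxPowLeJacobian_succ hres hx c).and (h.comp he)).mono fun a ha =>
    ha.1 (Ideal.Quotient.mkₐ ℂ _) (Ideal.Quotient.mkₐ_surjective ℂ _)
      (Ideal.Quotient.mkₐ_ker ℂ _) k ha.2

theorem IsOfType.succ (hres : Function.Surjective (algebraMap ℂ (ResidueField R))) {δ : ℤ} {ν : ℕ}
    (hδ : -1 ≤ δ) (h : IsOfType R δ ν) : IsOfType R (δ + 1) ν := by
  refine ⟨fun p _ hp => ?_, fun N x hx => ?_⟩
  · obtain ⟨d, hd, hdδ⟩ := h.1 p hp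
    exact ⟨d, hd, by omega⟩
  · let p : ℕ → Prop := fun c => ForGeneral fun a : Fin c × Fin N → ℂ =>
      MaxPowLeJacobian (LinearSection x c a) (ν - 1)
    change p (δ + 1 + 2).toNat
    rw [show (δ + 1 + 2).toNat = (δ + 2).toNat + 1 by omega]
    exact forGeneral_linearSection_succ hres hx (h.2 N x hx)

theorem IsOfType.mono (hres : Function.Surjective (algebraMap ℂ (ResidueField R))) {δ δ' : ℤ}
    {ν ν' : ℕ} (hδ : -1 ≤ δ) (hδδ' : δ ≤ δ') (hνν' : ν ≤ ν') (h : IsOfType R δ ν) :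
    IsOfType R δ' ν' := by
  have h1 : IsOfType R δ' ν := by
    induction δ', hδδ' using Int.leInduction with
    | base => exact h
    | succ m hm ih => exact ih.succ hres (hδ.trans hm)
  exact ⟨h1.1, fun N x hx => (h1.2 N x hx).mono fun a ha => ha.mono (Nat.sub_le_sub_right hνν' 1)⟩

end Types

end SingType

theorem proposition2p1 (R : Type*) [CommRing R] [IsLocalRing R] [Algebra ℂ R]
    [Algebra.EssFiniteType ℂ R]
    (hres : Function.Surjective (algebraMap ℂ (IsLocalRing.ResidueField R))) :
    (SingType.IsIsolatedSingularity R →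
      SingType.nu R ≠ ⊤ ∧
      ∀ (N : ℕ) (x : Fin N → IsLocalRing.maximalIdeal R),
        Submodule.span R (Set.range x) = ⊤ →
          SingType.ForGeneral fun a : Fin 1 × Fin N → ℂ =>
            SingType.nu (SingType.LinearSection x 1 a) ≤ SingType.nu R) ∧
    (IsDomain R → IsIntegrallyClosed R →
      ∀ (δ δ' : ℤ) (ν ν' : ℕ), -1 ≤ δ → 1 ≤ ν → δ ≤ δ' → ν ≤ ν' →
        SingType.IsOfType R δ ν → SingType.IsOfType R δ' ν') := by
  refine ⟨fun h => ⟨?_, fun N x hx => SingType.forGeneral_nu_le hres hx⟩,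
    fun _ _ δ δ' ν ν' hδ _ hδδ' hνν' h => h.mono hres hδ hδδ' hνν'⟩
  obtain ⟨k, hk⟩ := SingType.exists_maxPowLeJacobian hres h
  exact SingType.nu_ne_top hk
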